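/- Let $\mathbb Z_n=\mathbb Z/n\mathbb Z$ and let $U(n)$ be its group of units. A sequence in $\mathbb Z_n$ is said to have a $U(n)$-weighted zero-sum subsequence of length $m\ge 1$ if for some set $I$ of $m$ indices there are $u_i\in U(n)$ $(i\in I)$ with $\sum_{i\in I}u_ix_i=0$. The Gao constant $E_{U(n)}(n)$ is the least positive integer $k$ such that every sequence of length $k$ in $\mathbb Z_n$ has a $U(n)$-weighted zero-sum subsequence of length $n$. A sequence is $U(n)$-extremal for the Gao constant if it has length $E_{U(n)}(n)-1$ and has no $U(n)$-weighted zero-sum subsequence of length $n$. Sequences $(x_1,\dots,x_k)$ and $(y_1,\dots,y_k)$ in $\mathbb Z_n$ are $U(n)$-equivalent if there are $c\in U(n)$, a permutation $\sigma$ of $\{1,\dots,k\}$ and $u_1,\dots,u_k\in U(n)$ such that $c\,y_{\sigma(i)}=u_ix_i$ for all $i$. **Theorem.** Let $n=2^rp$, where $p$ is an odd prime and $r\ge 2$, and let $S$ be a sequence in $\mathbb Z_n$ which has exactly one odd term. Then $S$ is $U(n)$-extremal for the Gao constant if and only if $S$ is $U(n)$-equivalent to a sequence (the images in $\mathbb Z_n$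 of integers) of one of the following forms: - $(\star)$: $(b_1,\,p_1b_2,\,p_1p_2b_3,\,\dots,\,p_1\cdots p_{k-1}b_k,\,0,\dots,0)$ with $n-1$ zeroes at the end, where $n=p_1\cdots p_k$ with all $p_i$ prime (in any order), and $b_i$ is coprime to $p_i$ for $1\le i\le k$; - $(\ast)$: $(b_1,\,p_1b_2,\,p_1p_2b_3,\,\dots,\,p_1\cdots p_{k-1}b_k,\,n/2,\dots,n/2,\,0,\dots,0)$ with $m$ terms $n/2$ followed by $n-m$ zeroes, where $n=2p_1\cdots p_k$ with $k\ge1$ and all $p_i$ prime (in any order, possibly equal to $2$), $m\le n$ is odd, and $b_i$ is coprime to $p_i$ for $1\le i\le k$; - $(\ast\ast)$: $(a_0,\,2a_1,\,\dots,\,2^{r-2}a_{r-2},\,c,\,2^{r-1},\,n/2,\dots,n/2)$ with $n-1$ terms $n/2$, where $a_0,\dots,a_{r-2}$ are odd and $c$ is divisible by $2^r$. -/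

import Mathlib

/-- `HasWeightedZeroSumSubseq A S m`: the sequence `S` has an `A`-weighted zero-sum subsequence
of length `m`. Subsequences are given by non-empty sets of indices. -/
def HasWeightedZeroSumSubseq {R : Type*} [Ring R] (A : Set R) (S : List R) (m : ℕ) : Prop :=
  ∃ I : Finset (Fin S.length), I.Nonempty ∧ I.card = m ∧
    ∃ a : Fin S.length → R, (∀ i ∈ I, a i ∈ A) ∧ ∑ i ∈ I, a i * S.get i = 0

/-- The `A`-weighted Gao constant `E_A(R)` of a finite ring `R`: the least positive integer `k`
such that every sequence of length `k` in `R` has an `A`-weighted zero-sum subsequence of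
length `|R|`. -/
noncomputable def gaoConstant {R : Type*} [Ring R] (A : Set R) : ℕ :=
  sInf {k : ℕ | 0 < k ∧ ∀ S : List R, S.length = k → HasWeightedZeroSumSubseq A S (Nat.card R)}

/-- `S` is an `A`-extremal sequence for the Gao constant: its length is `E_A(n) - 1` and it has
no `A`-weighted zero-sum subsequence of length `n`. -/
def IsGaoExtremal {n : ℕ} (A : Set (ZMod n)) (S : List (ZMod n)) : Prop :=
  S.length + 1 = gaoConstant A ∧ ¬ HasWeightedZeroSumSubseq A S n

/-- `U(n)`, the set of units of `ℤ/nℤ`. -/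
def unitWeights (n : ℕ) : Set (ZMod n) := {x | IsUnit x}

/-- `S` and `T` are `A`-equivalent: `c * y_{σ(i)} = a_i * x_i` for some unit `c`, some
permutation `σ` and some `a_i ∈ A`. The bijection `σ` forces `S` and `T` to have equal length. -/
def WeightEquivalent {n : ℕ} (A : Set (ZMod n)) (S T : List (ZMod n)) : Prop :=
  ∃ (c : ZMod n) (σ : Fin S.length ≃ Fin T.length) (a : Fin S.length → ZMod n),
    IsUnit c ∧ (∀ i, a i ∈ A) ∧ ∀ i, c * T.get (σ i) = a i * S.get i

/-- The sequence `(b₁, q₁ b₂, q₁ q₂ b₃, …, q₁ ⋯ q_{k-1} b_k)` in `ℤ/nℤ`. -/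
def chainSeq (n : ℕ) {k : ℕ} (q : Fin k → ℕ) (b : Fin k → ℤ) : List (ZMod n) :=
  List.ofFn fun i : Fin k => (((∏ j ∈ Finset.Iio i, (q j : ℤ)) * b i : ℤ) : ZMod n)

/-- The form `(⋆)`: `(b₁, q₁ b₂, …, q₁ ⋯ q_{k-1} b_k, 0, …, 0)` with `n - 1` final zeroes, where
`n = q₁ ⋯ q_k` with `q_i` prime, and `b_i` is coprime to `q_i`. -/
def IsStarForm (n : ℕ) (S : List (ZMod n)) : Prop :=
  ∃ (k : ℕ) (q : Fin k → ℕ) (b : Fin k → ℤ),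
    (∀ i, (q i).Prime) ∧ n = ∏ i, q i ∧ (∀ i, IsCoprime (b i) (q i : ℤ)) ∧
    S = chainSeq n q b ++ List.replicate (n - 1) 0

/-- The form `(∗)`: `(b₁, q₁ b₂, …, q₁ ⋯ q_{k-1} b_k, n/2, …, n/2, 0, …, 0)` with `m` terms `n/2`
and `n - m` zeroes, where `n = 2 q₁ ⋯ q_k` with `k ≥ 1` and `q_i` prime, `m` is odd, and `b_i` is
coprime to `q_i`. -/
def IsAstForm (n : ℕ) (S : List (ZMod n)) : Prop :=
  ∃ (k : ℕ) (q : Fin k → ℕ) (b : Fin k → ℤ) (m : ℕ),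
    0 < k ∧ (∀ i, (q i).Prime) ∧ n = 2 * ∏ i, q i ∧ (∀ i, IsCoprime (b i) (q i : ℤ)) ∧
    Odd m ∧ m ≤ n ∧
    S = chainSeq n q b ++ List.replicate m ((n / 2 : ℕ) : ZMod n) ++ List.replicate (n - m) 0

/-- The form `(∗∗)` for `n = 2 ^ (s + 1) * q` with `q` an odd prime:
`(a₀, 2 a₁, …, 2 ^ (s - 1) a_{s-1}, c, 2 ^ s, n/2, …, n/2)` with `n - 1` terms `n/2`, where all
`a_i` are odd and `2 ^ (s + 1)` divides `c`. -/
def IsDoubleAstForm (n : ℕ) (S : List (ZMod n)) : Prop :=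
  ∃ (s q : ℕ) (a : Fin s → ℤ) (c : ℤ),
    q.Prime ∧ q ≠ 2 ∧ n = 2 ^ (s + 1) * q ∧ (∀ i, Odd (a i)) ∧ (2 : ℤ) ^ (s + 1) ∣ c ∧
    S = List.ofFn (fun i : Fin s => ((2 ^ (i : ℕ) * a i : ℤ) : ZMod n)) ++
      [(c : ZMod n), (2 : ZMod n) ^ s] ++ List.replicate (n - 1) ((n / 2 : ℕ) : ZMod n)

/-! By the Chinese remainder theorem, the class of a residue modulo `n = 2 ^ r * p` up to units is
its type: the 2-adic valuation capped at `r`, and whether `p` divides it. Hence `U(n)`-equivalence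
of sequences is equality of their multisets of types (`weightEquivalent_iff`). An index set of even
size carries a unit-weighted zero-sum exactly when its types are balanced
(`exists_unit_weights_iff`): modulo `2 ^ r`, after dividing by the least power of 2 present, only
parity obstructs; modulo `p`, only a single nonzero term obstructs. As `n` is even, the theorem
becomes a statement on multisets of types.

That statement is proved by induction on the cap `R`, with `n` held fixed as any even number at
least 4, not tied to `2 ^ R * p`. Remove the members of valuation zero and lower the other
valuations by one. With at least two such members one can usually select a balanced `n`-submultiset
by counting alone (`exists_bottom_counts`); with at most one, the rest is handled by induction. This
gives the bound `n + R + 1` (`hasBalanced_of_card_eq`). One member fewer, the induction leaves few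
ways to fail. A single bottom member puts a new odd term in front of a smaller extremal list. Two
bottom members, exactly one prime to `p`, over multiples of `p` lead to `(∗)` through the extremal
problem for the 2-part. The cap `R = 1` yields further cases of `(∗)` and all of `(∗∗)`, and `R = 0`
yields `(⋆)`.

Conversely, a chain term is either the only member of minimal valuation or the only one prime to `p`
among itself and everything after it, so no balanced submultiset uses it
(`PrimeChain.le_of_isBalanced`). The remaining tail fails by size, by parity, or by a lone term
prime to `p`. -/

/-! ### Types of residues and balanced multisets -/

/-- The type of a residue: its capped 2-adic valuation, and whether the odd prime divides it. -/
abbrev ResidueType := ℕ × Bool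

/-- A multiset of types which belongs to an index set with a unit-weighted zero-sum: evenly many
members have minimal valuation, and the number of members prime to the odd prime is not one. -/
def IsBalanced (M : Multiset ResidueType) : Prop :=
  (∃ w, (∀ t ∈ M, w ≤ t.1) ∧ 0 < M.countP (fun t => t.1 = w) ∧
    Even (M.countP fun t => t.1 = w)) ∧ M.countP (fun t => t.2 = false) ≠ 1

theorem exists_le_card_eq {α : Type*} {s : Multiset α} {n : ℕ} (h : n ≤ s.card) :
    ∃ t ≤ s, t.card = n := by
  induction s using Quotient.inductionOn with
  | h l =>
    refine ⟨(l.take n : List α), (List.take_sublist n l).subperm, ?_⟩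
    simpa using h

/-- `M` has a balanced submultiset with `n` members. -/
def HasBalanced (n : ℕ) (M : Multiset ResidueType) : Prop :=
  ∃ M' ≤ M, M'.card = n ∧ IsBalanced M'

/-- The effect on types of multiplication by 2. -/
def shiftType (t : ResidueType) : ResidueType := (t.1 + 1, t.2)

theorem HasBalanced.mono {n : ℕ} {M N : Multiset ResidueType} (h : HasBalanced n M)
    (hMN : M ≤ N) : HasBalanced n N := by
  obtain ⟨M', h1, h2⟩ := h
  exact ⟨M', h1.trans hMN, h2⟩

theorem IsBalanced.map_shiftType {M : Multiset ResidueType} (h : IsBalanced M) :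
    IsBalanced (M.map shiftType) := by
  obtain ⟨⟨w, h1, h2, h3⟩, h4⟩ := h
  have e : (M.map shiftType).countP (fun t => t.1 = w + 1) = M.countP (fun t => t.1 = w) := by
    rw [Multiset.countP_map, Multiset.countP_eq_card_filter]
    simp [shiftType]
  refine ⟨⟨w + 1, ?_, by omega, by rwa [e]⟩, ?_⟩
  · intro t ht
    obtain ⟨s, hs, rfl⟩ := Multiset.mem_map.1 ht
    simpa [shiftType] using h1 s hs
  · rw [Multiset.countP_map]
    rw [Multiset.countP_eq_card_filter] at h4
    convert h4 using 1
    congr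

theorem HasBalanced.map_shiftType {n : ℕ} {M : Multiset ResidueType} (h : HasBalanced n M) :
    HasBalanced n (M.map shiftType) := by
  obtain ⟨M', h1, h2, h3⟩ := h
  exact ⟨M'.map shiftType, Multiset.map_le_map h1, by simpa using h2, h3.map_shiftType⟩

/-! ### Splitting off the members of valuation zero -/

/-- The multiset of types with `a` and `b` members of valuation zero, divisible and not divisible
by the odd prime respectively, the other members being the shifts of those of `M`. -/
def withBottom (a b : ℕ) (M : Multiset ResidueType) : Multiset ResidueType :=
  Multiset.replicate a (0, true) + Multiset.replicate b (0, false) + M.map shiftType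

theorem card_withBottom (a b : ℕ) (M : Multiset ResidueType) :
    (withBottom a b M).card = a + b + M.card := by
  simp [withBottom]

theorem exists_eq_withBottom (M : Multiset ResidueType) :
    ∃ a b M', M = withBottom a b M' := by
  induction M using Multiset.induction with
  | empty => exact ⟨0, 0, 0, by simp [withBottom]⟩
  | cons t M ih =>
    obtain ⟨a, b, M', rfl⟩ := ih
    obtain ⟨v, e⟩ := t
    cases v with
    | succ v =>
      exact ⟨a, b, (v, e) ::ₘ M', by simp [withBottom, shiftType]⟩
    | zero =>
      cases e
      · exact ⟨a, b + 1, M', by simp [withBottom, Multiset.replicate_succ]⟩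
      · exact ⟨a + 1, b, M', by simp [withBottom, Multiset.replicate_succ]⟩

theorem le_of_mem_withBottom {a b R : ℕ} {M : Multiset ResidueType}
    (h : ∀ t ∈ withBottom a b M, t.1 ≤ R + 1) : ∀ t ∈ M, t.1 ≤ R := by
  intro t ht
  have := h (shiftType t) (by
    simp only [withBottom, Multiset.mem_add]
    exact Or.inr (Multiset.mem_map_of_mem _ ht))
  simpa [shiftType] using this

theorem HasBalanced.withBottom {n : ℕ} {M : Multiset ResidueType} (h : HasBalanced n M)
    (a b : ℕ) : HasBalanced n (withBottom a b M) :=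
  h.map_shiftType.mono (Multiset.le_add_left _ _)

theorem countP_false_add_true (M : Multiset ResidueType) :
    M.countP (fun t => t.2 = true) + M.countP (fun t => t.2 = false) = M.card := by
  have := Multiset.card_eq_countP_add_countP (fun t : ResidueType => t.2 = true) M
  simpa using this.symm

/-- Once a member of valuation zero is selected, the minimal valuation is zero, so balance depends
only on four counts: bottom or higher, divisible by the odd prime or not. The valuations of the
higher members play no role. -/
theorem hasBalanced_withBottom {n a b : ℕ} {M : Multiset ResidueType} (a' b' c' d' : ℕ)
    (ha : a' ≤ a) (hb : b' ≤ b) (hc : c' ≤ M.countP (fun t => t.2 = true))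
    (hd : d' ≤ M.countP (fun t => t.2 = false)) (hn : a' + b' + c' + d' = n)
    (h0 : 0 < a' + b') (he : Even (a' + b')) (h1 : b' + d' ≠ 1) :
    HasBalanced n (withBottom a b M) := by
  rw [Multiset.countP_eq_card_filter] at hc hd
  obtain ⟨C, hC, rfl⟩ := exists_le_card_eq hc
  obtain ⟨D, hD, rfl⟩ := exists_le_card_eq hd
  have hCe : ∀ t ∈ C, t.2 = true := fun t ht => (Multiset.mem_filter.1 (Multiset.mem_of_le hC ht)).2
  have hDe : ∀ t ∈ D, t.2 = false :=
    fun t ht => (Multiset.mem_filter.1 (Multiset.mem_of_le hD ht)).2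
  have hCD : C + D ≤ M := by
    have := Multiset.filter_add_not (fun t : ResidueType => t.2 = true) M
    rw [← this]
    simp only [Bool.not_eq_true]
    exact add_le_add hC hD
  refine ⟨withBottom a' b' (C + D), ?_, by rw [card_withBottom, Multiset.card_add]; omega, ?_, ?_⟩
  · unfold withBottom
    exact add_le_add (add_le_add (Multiset.replicate_mono _ ha) (Multiset.replicate_mono _ hb))
      (Multiset.map_le_map hCD)
  · have e : (withBottom a' b' (C + D)).countP (fun t => t.1 = 0) = a' + b' := by
      simp [withBottom, Multiset.countP_add, Multiset.countP_map, shiftType,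
        ← Multiset.coe_replicate, List.countP_replicate]
    exact ⟨0, fun _ _ => Nat.zero_le _, by omega, by rwa [e]⟩
  · have e : (withBottom a' b' (C + D)).countP (fun t => t.2 = false) = b' + D.card := by
      have e1 : C.filter (fun t => t.2 = false) = 0 := by
        rw [Multiset.filter_eq_nil]; intro t ht; simp [hCe t ht]
      have e2 : D.filter (fun t => t.2 = false) = D := by
        rw [Multiset.filter_eq_self]; exact hDe
      simp [withBottom, Multiset.countP_add, Multiset.countP_map, shiftType,
        ← Multiset.coe_replicate, List.countP_replicate]
      convert congrArg₂ (fun x y : Multiset ResidueType => x.card + y.card) e1 e2 using 1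
      · congr
      · simp
    omega

/-- Take nearly as many bottom members as parity and `n` allow, and fill up from above, preferring
members prime to `p`. The surplus `B ≥ 2` leaves room to drop a lone such member together with one
more. In the excluded case the only nonempty even choice is both bottom members, and it contains
exactly one member prime to `p`. -/
theorem exists_bottom_counts {n B a b c d : ℕ} (hn : Even n) (hn4 : 4 ≤ n) (hB : 2 ≤ B)
    (h : a + b + c + d = n + B) (hab : 2 ≤ a + b) (hex : ¬ (a = 1 ∧ b = 1 ∧ d = 0)) :
    ∃ a' b' c' d', a' ≤ a ∧ b' ≤ b ∧ c' ≤ c ∧ d' ≤ d ∧ a' + b' + c' + d' = n ∧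
      0 < a' + b' ∧ Even (a' + b') ∧ b' + d' ≠ 1 := by
  simp only [Nat.even_iff] at *
  rcases le_or_gt n (a + b) with hle | hlt
  · rcases Nat.lt_or_ge b 2 with hb | hb
    · rcases le_or_gt n a with hna | hna
      · exact ⟨n, 0, 0, 0, by omega⟩
      · rcases Nat.lt_or_ge d 2 with hd | hd
        · rcases Nat.eq_zero_or_pos d with rfl | hd0
          · exact ⟨n - 2, 0, 2, 0, by omega⟩
          · exact ⟨n - 3, 1, 1, 1, by omega⟩
        · exact ⟨n - 2, 0, 0, 2, by omega⟩
    · exact ⟨n - min b n, min b n, 0, 0, by omega⟩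
  · rcases Nat.even_or_odd (a + b) with he | ho
    · rw [Nat.even_iff] at he
      rcases Nat.lt_or_ge b 2 with hb | hb
      · rcases Nat.lt_or_ge d 2 with hd | hd
        · rcases Nat.eq_zero_or_pos b with rfl | hb0
          · exact ⟨a, 0, n - a, 0, by omega⟩
          · rcases Nat.eq_zero_or_pos d with rfl | hd0
            · exact ⟨a - 1, 0, n - (a - 1), 0, by omega⟩
            · exact ⟨a, b, n - a - b - 1, 1, by omega⟩
        · exact ⟨a, b, n - a - b - min d (n - a - b), min d (n - a - b), by omega⟩
      · exact ⟨a, b, n - a - b - min d (n - a - b), min d (n - a - b), by omega⟩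
    · rw [Nat.odd_iff] at ho
      have hK : n + 1 - a - b ≤ c + d - 1 := by omega
      rcases Nat.lt_or_ge b 3 with hb | hb
      · rcases Nat.lt_or_ge b 2 with hb1 | hb1
        · rcases Nat.lt_or_ge d 2 with hd | hd
          · exact ⟨a + b - 1, 0, n + 1 - a - b, 0, by omega⟩
          · exact ⟨a + b - 1, 0, n + 1 - a - b - min d (n + 1 - a - b), min d (n + 1 - a - b),
              by omega⟩
        · exact ⟨a - 1, 2, n + 1 - a - b - min d (n + 1 - a - b), min d (n + 1 - a - b), by omega⟩
      · exact ⟨a, b - 1, n + 1 - a - b - min d (n + 1 - a - b), min d (n + 1 - a - b), by omega⟩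

/-- Here exactly one member is dropped. The three excluded configurations are those where every
omission leaves either an odd bottom or exactly one member prime to `p`; they become the extremal
cases for `R = 1`. -/
theorem exists_bottom_counts_one {n a b c d : ℕ} (hn : Even n)
    (h : a + b + c + d = n + 1) (hab : 2 ≤ a + b) (h1 : ¬ (b = 1 ∧ d = 0 ∧ Odd a))
    (h2 : ¬ (b = 1 ∧ a + b = n)) (h3 : ¬ (b = 0 ∧ d = 1 ∧ Odd a)) :
    ∃ a' b' c' d', a' ≤ a ∧ b' ≤ b ∧ c' ≤ c ∧ d' ≤ d ∧ a' + b' + c' + d' = n ∧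
      0 < a' + b' ∧ Even (a' + b') ∧ b' + d' ≠ 1 := by
  simp only [Nat.even_iff, Nat.odd_iff] at *
  rcases Nat.even_or_odd (a + b) with he | ho
  · rw [Nat.even_iff] at he
    rcases Nat.lt_or_ge d 2 with hd | hd
    · rcases Nat.eq_zero_or_pos b with rfl | hb0
      · exact ⟨a, 0, n - a, 0, by omega⟩
      · exact ⟨a, b, n - a - b - min d (n - a - b), min d (n - a - b), by omega⟩
    · exact ⟨a, b, n - a - b - min d (n - a - b), min d (n - a - b), by omega⟩
  · rw [Nat.odd_iff] at ho
    rcases Nat.lt_or_ge b 3 with hb | hb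
    · rcases Nat.lt_or_ge b 2 with hb1 | hb1
      · by_cases hd : b = 1 ∧ d = 1
        · exact ⟨a - 1, 1, c, d, by omega⟩
        · exact ⟨a + b - 1, 0, c, d, by omega⟩
      · exact ⟨a - 1, 2, c, d, by omega⟩
    · exact ⟨a, b - 1, c, d, by omega⟩

/-! ### Upper bounds for multisets of types -/

/-- Upper bound for the 2-part alone. -/
theorem hasBalanced_of_forall_true {n : ℕ} (hn : Even n) (hn4 : 4 ≤ n) (R : ℕ)
    (M : Multiset ResidueType) (hM : ∀ t ∈ M, t.1 ≤ R) (ht : ∀ t ∈ M, t.2 = true)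
    (hc : M.card = n + R) : HasBalanced n M := by
  induction R generalizing M with
  | zero =>
    have e : M.countP (fun t => t.1 = 0) = n := by
      rw [Multiset.countP_eq_card.2 (fun t h => Nat.le_zero.1 (hM t h))]; exact hc
    refine ⟨M, le_rfl, hc, ⟨0, fun _ _ => Nat.zero_le _, by omega, by rwa [e]⟩, ?_⟩
    rw [Multiset.countP_eq_zero.2 (fun t h => by simp [ht t h])]; omega
  | succ R ih =>
    obtain ⟨a, b, M', rfl⟩ := exists_eq_withBottom M
    have hM' := le_of_mem_withBottom hM
    have ht' : ∀ t ∈ M', t.2 = true := fun t h => ht (shiftType t) (by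
      simp only [withBottom, Multiset.mem_add]
      exact Or.inr (Multiset.mem_map_of_mem _ h))
    rw [card_withBottom] at hc
    have hb : b = 0 := by
      by_contra hb
      simpa using ht (0, false) (by simp [withBottom, Multiset.mem_replicate, hb])
    rcases Nat.lt_or_ge a 2 with ha | ha
    · obtain ⟨M'', hle, hM''⟩ := exists_le_card_eq (s := M') (n := n + R) (by omega)
      exact ((ih M'' (fun t h => hM' t (Multiset.mem_of_le hle h))
        (fun t h => ht' t (Multiset.mem_of_le hle h)) hM'').mono hle).withBottom a b
    · have hcd := countP_false_add_true M'
      have hd : M'.countP (fun t => t.2 = false) = 0 :=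
        Multiset.countP_eq_zero.2 (fun t h => by simp [ht' t h])
      rw [Nat.even_iff] at hn
      -- The number of bottom members taken is the largest even number that is at most both `a` and
      -- `n`.
      refine hasBalanced_withBottom (min n (a - a % 2)) 0 (n - min n (a - a % 2)) 0 ?_ ?_ ?_ ?_ ?_ ?_
        (Nat.even_iff.2 ?_) ?_ <;> omega

/-- Upper bound for the Gao constant, in terms of types. -/
theorem hasBalanced_of_card_eq {n : ℕ} (hn : Even n) (hn4 : 4 ≤ n) (R : ℕ)
    (M : Multiset ResidueType) (hM : ∀ t ∈ M, t.1 ≤ R) (hc : M.card = n + R + 1) :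
    HasBalanced n M := by
  induction R generalizing M with
  | zero =>
    obtain ⟨M', hle, hM', h1⟩ : ∃ M' ≤ M, M'.card = n ∧ M'.countP (fun t => t.2 = false) ≠ 1 := by
      have hcd := countP_false_add_true M
      rw [Multiset.countP_eq_card_filter, Multiset.countP_eq_card_filter] at hcd
      obtain ⟨c', d', h1, h2, h3, h4⟩ : ∃ c' d', c' ≤ (M.filter fun t => t.2 = true).card ∧
          d' ≤ (M.filter fun t => t.2 = false).card ∧ c' + d' = n ∧ d' ≠ 1 := by
        rcases Nat.lt_or_ge (M.filter fun t => t.2 = false).card 2 with h | h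
        · exact ⟨n, 0, by omega⟩
        · exact ⟨n - min n (M.filter fun t => t.2 = false).card,
            min n (M.filter fun t => t.2 = false).card, by omega⟩
      obtain ⟨C, hC, rfl⟩ := exists_le_card_eq h1
      obtain ⟨D, hD, rfl⟩ := exists_le_card_eq h2
      refine ⟨C + D, ?_, by simpa using h3, ?_⟩
      · have := Multiset.filter_add_not (fun t : ResidueType => t.2 = true) M
        rw [← this]
        simp only [Bool.not_eq_true]
        exact add_le_add hC hD
      · rw [Multiset.countP_add, Multiset.countP_eq_zero.2, Multiset.countP_eq_card.2, zero_add]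
        · exact h4
        · exact fun t ht => (Multiset.mem_filter.1 (Multiset.mem_of_le hD ht)).2
        · intro t ht
          simp [(Multiset.mem_filter.1 (Multiset.mem_of_le hC ht)).2]
    have e : M'.countP (fun t => t.1 = 0) = n := by
      rw [Multiset.countP_eq_card.2 (fun t h => Nat.le_zero.1 (hM t (Multiset.mem_of_le hle h)))]
      exact hM'
    exact ⟨M', hle, hM', ⟨0, fun _ _ => Nat.zero_le _, by omega, by rwa [e]⟩, h1⟩
  | succ R ih =>
    obtain ⟨a, b, M', rfl⟩ := exists_eq_withBottom M
    have hM' := le_of_mem_withBottom hM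
    rw [card_withBottom] at hc
    rcases Nat.lt_or_ge (a + b) 2 with hab | hab
    · obtain ⟨M'', hle, hM''⟩ := exists_le_card_eq (s := M') (n := n + R + 1) (by omega)
      exact ((ih M'' (fun t h => hM' t (Multiset.mem_of_le hle h)) hM'').mono hle).withBottom a b
    · have hcd := countP_false_add_true M'
      by_cases hex : a = 1 ∧ b = 1 ∧ M'.countP (fun t => t.2 = false) = 0
      -- Discarding both bottom members leaves `n + R` multiples of `p`, which suffices for the
      -- 2-part alone.
      · refine (hasBalanced_of_forall_true hn hn4 R M' hM' ?_ (by omega)).withBottom a b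
        intro t h
        simpa using Multiset.countP_eq_zero.1 hex.2.2 t h
      · obtain ⟨a', b', c', d', h⟩ := exists_bottom_counts (B := R + 2)
          (c := M'.countP fun t => t.2 = true) hn hn4 (by omega) (by omega) hab hex
        exact hasBalanced_withBottom a' b' c' d' h.1 h.2.1 h.2.2.1 h.2.2.2.1 h.2.2.2.2.1
          h.2.2.2.2.2.1 h.2.2.2.2.2.2.1 h.2.2.2.2.2.2.2

/-! ### Integer models of the three forms and their types -/

/-- The lists `(b₁, q₁ b₂, q₁ q₂ b₃, …)` of integers with `q₁ q₂ ⋯ = d`, where the `q_i` are prime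
and `b_i` is coprime to `q_i`. -/
inductive PrimeChain : ℕ → List ℤ → Prop
  | nil : PrimeChain 1 []
  | cons {q d : ℕ} {b : ℤ} {L : List ℤ} (hq : q.Prime) (hb : IsCoprime b (q : ℤ))
      (h : PrimeChain d L) : PrimeChain (q * d) (b :: L.map fun x => (q : ℤ) * x)

/-- The type of an integer, with 2-adic valuation capped at `R`. -/
noncomputable def resType (p R : ℕ) (x : ℤ) : ResidueType :=
  (Nat.findGreatest (fun k => (2 : ℤ) ^ k ∣ x) R, decide ((p : ℤ) ∣ x))

theorem resType_fst_le (p R : ℕ) (x : ℤ) : (resType p R x).1 ≤ R := Nat.findGreatest_le _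

theorem le_resType_fst_iff {p R k : ℕ} (hk : k ≤ R) (x : ℤ) :
    k ≤ (resType p R x).1 ↔ (2 : ℤ) ^ k ∣ x := by
  constructor
  · intro h
    have := Nat.findGreatest_spec (P := fun k => (2 : ℤ) ^ k ∣ x) (Nat.zero_le R) (by simp)
    exact (pow_dvd_pow 2 h).trans this
  · exact fun h => Nat.le_findGreatest hk h

theorem resType_snd_eq_false {p R : ℕ} {x : ℤ} : (resType p R x).2 = false ↔ ¬ (p : ℤ) ∣ x := by
  simp [resType]

theorem resType_fst_eq {p R k : ℕ} (hk : k ≤ R) {x : ℤ} (h : (2 : ℤ) ^ k ∣ x)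
    (h' : k < R → ¬ (2 : ℤ) ^ (k + 1) ∣ x) : (resType p R x).1 = k := by
  apply le_antisymm _ ((le_resType_fst_iff hk x).2 h)
  by_contra hlt
  have hkR := lt_of_lt_of_le (not_le.1 hlt) (resType_fst_le p R x)
  exact h' hkR ((le_resType_fst_iff hkR x).1 (not_le.1 hlt))

theorem resType_fst_of_odd {p R : ℕ} {x : ℤ} (h : Odd x) : (resType p R x).1 = 0 :=
  resType_fst_eq (Nat.zero_le _) (by simp) fun _ => by
    rw [zero_add, pow_one, ← even_iff_two_dvd, Int.not_even_iff_odd]; exact h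

theorem resType_fst_of_dvd {p R : ℕ} {x : ℤ} (h : (2 : ℤ) ^ R ∣ x) : (resType p R x).1 = R :=
  resType_fst_eq le_rfl h fun h => (lt_irrefl _ h).elim

theorem resType_fst_of_mul {p R k : ℕ} (hk : k ≤ R) {x : ℤ} (h : Odd x) :
    (resType p R (2 ^ k * x)).1 = k :=
  resType_fst_eq hk (Dvd.intro _ rfl) fun _ hd => by
    rw [pow_succ] at hd
    have := (mul_dvd_mul_iff_left (pow_ne_zero k two_ne_zero)).1 hd
    rw [← even_iff_two_dvd] at this
    exact (Int.not_even_iff_odd.2 h) this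

theorem exists_two_pow_mul {p R : ℕ} (x : ℤ) : ∃ y, x = 2 ^ (resType p R x).1 * y ∧
    ((resType p R x).1 < R → Odd y) := by
  obtain ⟨y, hy⟩ := (le_resType_fst_iff (resType_fst_le p R x) x).1 le_rfl
  refine ⟨y, hy, fun h => ?_⟩
  by_contra ho
  rw [Int.not_odd_iff_even, even_iff_two_dvd] at ho
  have : (2 : ℤ) ^ ((resType p R x).1 + 1) ∣ x := by
    nth_rw 2 [hy]
    rw [pow_succ]
    exact mul_dvd_mul_left _ ho
  have := (le_resType_fst_iff (p := p) h x).2 this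
  omega

theorem odd_natCast_of_prime {p : ℕ} (hp : p.Prime) (hp2 : p ≠ 2) : Odd (p : ℤ) := by
  exact_mod_cast hp.odd_of_ne_two hp2

theorem prime_dvd_two_pow_mul_iff {p : ℕ} (hp : p.Prime) (hp2 : p ≠ 2) (k : ℕ) (x : ℤ) :
    (p : ℤ) ∣ 2 ^ k * x ↔ (p : ℤ) ∣ x := by
  have h : IsCoprime (p : ℤ) (2 ^ k : ℤ) := by
    have : Nat.Coprime p (2 ^ k) :=
      Nat.Coprime.pow_right _ ((Nat.coprime_primes hp Nat.prime_two).2 hp2)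
    exact_mod_cast Nat.isCoprime_iff_coprime.2 this
  exact ⟨h.dvd_of_dvd_mul_left, fun h => h.mul_left _⟩

theorem resType_two_mul {p : ℕ} (hp : p.Prime) (hp2 : p ≠ 2) (R : ℕ) (x : ℤ) :
    resType p (R + 1) (2 * x) = shiftType (resType p R x) := by
  refine Prod.ext ?_ ?_
  · refine resType_fst_eq (Nat.succ_le_succ (resType_fst_le p R x)) ?_ fun h => ?_
    · change (2 : ℤ) ^ ((resType p R x).1 + 1) ∣ _
      rw [pow_succ']
      exact mul_dvd_mul_left _ ((le_resType_fst_iff (resType_fst_le p R x) x).1 le_rfl)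
    · change ¬ (2 : ℤ) ^ ((resType p R x).1 + 1 + 1) ∣ _
      rw [pow_succ', mul_dvd_mul_iff_left two_ne_zero,
        ← le_resType_fst_iff (p := p) (R := R) (Nat.lt_of_succ_lt_succ h)]
      omega
  · have := prime_dvd_two_pow_mul_iff hp hp2 1 x
    rw [pow_one] at this
    simp [resType, shiftType, this]

theorem resType_odd_mul {p R : ℕ} {u : ℤ} (hu : Odd u) (x : ℤ) :
    (resType p R (u * x)).1 = (resType p R x).1 := by
  have h2 : ∀ k : ℕ, (2 : ℤ) ^ k ∣ u * x ↔ 2 ^ k ∣ x := fun k => by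
    have : IsCoprime ((2 : ℤ) ^ k) u := (Int.isCoprime_two_left.2 hu).pow_left
    exact ⟨this.dvd_of_dvd_mul_left, fun h => h.mul_left _⟩
  simp [resType, h2]

theorem exists_odd_resType_eq {p : ℕ} (hp : p.Prime) (hp2 : p ≠ 2) (R : ℕ) (e : Bool) :
    ∃ b : ℤ, Odd b ∧ resType p R b = (0, e) := by
  cases e
  · refine ⟨1, odd_one, Prod.ext (resType_fst_of_odd odd_one) ?_⟩
    exact resType_snd_eq_false.2 fun h => hp.one_lt.ne' (by exact_mod_cast Int.eq_one_of_dvd_one (by positivity) h)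
  · have := odd_natCast_of_prime hp hp2
    exact ⟨p, this, Prod.ext (resType_fst_of_odd this) (by simp [resType])⟩

theorem isCoprime_natCast_iff_not_dvd {p : ℕ} (hp : p.Prime) (b : ℤ) :
    IsCoprime b (p : ℤ) ↔ ¬ (p : ℤ) ∣ b := by
  rw [isCoprime_comm]
  exact (Nat.prime_iff_prime_int.1 hp).coprime_iff_not_dvd

/-- The 2-power part of the extremal sequences `(∗)`. -/
def IsTwoForm (n R : ℕ) (L : List ℤ) : Prop :=
  ∃ C m, PrimeChain (2 ^ R) C ∧ Odd m ∧ m ≤ n ∧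
    L = C ++ List.replicate m ((2 : ℤ) ^ R) ++ List.replicate (n - m) 0

/-- The integer form of `(⋆)` for modulus `2 ^ R * p`. -/
def IsStarList (n p R : ℕ) (L : List ℤ) : Prop :=
  ∃ C, PrimeChain (2 ^ R * p) C ∧ L = C ++ List.replicate (n - 1) 0

/-- The integer form of `(∗)` for modulus `2 ^ R * p`. -/
def IsAstList (n p R : ℕ) (L : List ℤ) : Prop :=
  ∃ s C m, R = s + 1 ∧ PrimeChain (2 ^ s * p) C ∧ Odd m ∧ m ≤ n ∧
    L = C ++ List.replicate m ((2 : ℤ) ^ s * p) ++ List.replicate (n - m) 0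

/-- The integer form of `(∗∗)` for modulus `2 ^ R * p`. -/
def IsDoubleAstList (n p R : ℕ) (L : List ℤ) : Prop :=
  ∃ (s : ℕ) (a : Fin s → ℤ) (c : ℤ), R = s + 1 ∧ (∀ i, Odd (a i)) ∧ (2 : ℤ) ^ (s + 1) ∣ c ∧
    L = List.ofFn (fun i : Fin s => (2 : ℤ) ^ (i : ℕ) * a i) ++ [c, 2 ^ s] ++
      List.replicate (n - 1) ((2 : ℤ) ^ s * p)

/-- `M` is the multiset of types of a list of one of the three forms. -/
def IsExtremalTypes (n p R : ℕ) (M : Multiset ResidueType) : Prop :=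
  ∃ L : List ℤ, (IsStarList n p R L ∨ IsAstList n p R L ∨ IsDoubleAstList n p R L) ∧
    M = (L.map (resType p R) : List ResidueType)

theorem PrimeChain.cons_two {d : ℕ} {L : List ℤ} (h : PrimeChain d L) {b : ℤ} (hb : Odd b) :
    PrimeChain (2 * d) (b :: L.map fun x => 2 * x) :=
  PrimeChain.cons Nat.prime_two (Int.isCoprime_two_right.2 hb) h

theorem IsTwoForm.cons {n R : ℕ} {L : List ℤ} (h : IsTwoForm n R L) {b : ℤ} (hb : Odd b) :
    IsTwoForm n (R + 1) (b :: L.map fun x => 2 * x) := by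
  obtain ⟨C, m, h1, h2, h3, rfl⟩ := h
  refine ⟨_, m, by rw [pow_succ']; exact h1.cons_two hb, h2, h3, ?_⟩
  simp [pow_succ']

theorem IsStarList.cons {n p R : ℕ} {L : List ℤ} (h : IsStarList n p R L) {b : ℤ} (hb : Odd b) :
    IsStarList n p (R + 1) (b :: L.map fun x => 2 * x) := by
  obtain ⟨C, h1, rfl⟩ := h
  exact ⟨_, by rw [pow_succ', mul_assoc]; exact h1.cons_two hb, by simp⟩

theorem IsAstList.cons {n p R : ℕ} {L : List ℤ} (h : IsAstList n p R L) {b : ℤ} (hb : Odd b) :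
    IsAstList n p (R + 1) (b :: L.map fun x => 2 * x) := by
  obtain ⟨s, C, m, rfl, h1, h2, h3, rfl⟩ := h
  refine ⟨s + 1, _, m, rfl, by rw [pow_succ', mul_assoc]; exact h1.cons_two hb, h2, h3, ?_⟩
  simp [pow_succ', mul_assoc]

theorem IsDoubleAstList.cons {n p R : ℕ} {L : List ℤ} (h : IsDoubleAstList n p R L) {b : ℤ}
    (hb : Odd b) : IsDoubleAstList n p (R + 1) (b :: L.map fun x => 2 * x) := by
  obtain ⟨s, a, c, rfl, h1, h2, rfl⟩ := h
  refine ⟨s + 1, Fin.cons b a, 2 * c, rfl, Fin.cases hb h1, ?_, ?_⟩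
  · rw [pow_succ']; exact mul_dvd_mul_left _ h2
  · simp [pow_succ', mul_assoc, List.ofFn_succ, Function.comp_def]

/-- Putting `p` first in the order of the primes turns an extremal list for the 2-part into a list
`(∗)`. -/
theorem IsTwoForm.isAstList {n p R : ℕ} {L : List ℤ} (h : IsTwoForm n R L) (hp : p.Prime) {b : ℤ}
    (hb : ¬ (p : ℤ) ∣ b) : IsAstList n p (R + 1) (b :: L.map fun x => (p : ℤ) * x) := by
  obtain ⟨C, m, h1, h2, h3, rfl⟩ := h
  refine ⟨R, _, m, rfl, by
    rw [mul_comm]; exact h1.cons hp ((isCoprime_natCast_iff_not_dvd hp b).2 hb), h2, h3, ?_⟩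
  simp [mul_comm]

/-- All three forms are closed under doubling every term and prefixing an odd term; the prefixed
term may be a multiple of `p` or not, so it realises either bottom type. -/
theorem IsExtremalTypes.withBottom {n p R a b : ℕ} {M : Multiset ResidueType}
    (h : IsExtremalTypes n p R M) (hp : p.Prime) (hp2 : p ≠ 2) (hab : a + b = 1) :
    IsExtremalTypes n p (R + 1) (withBottom a b M) := by
  obtain ⟨L, hL, rfl⟩ := h
  have key : ∃ e, _root_.withBottom a b (L.map (resType p R) : List ResidueType) =
      (0, e) ::ₘ (L.map (resType p R) : Multiset ResidueType).map shiftType := by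
    rcases Nat.eq_zero_or_pos a with rfl | ha
    · obtain rfl : b = 1 := by omega
      exact ⟨false, by simp [_root_.withBottom]⟩
    · obtain ⟨rfl, rfl⟩ : a = 1 ∧ b = 0 := by omega
      exact ⟨true, by simp [_root_.withBottom]⟩
  obtain ⟨e, he⟩ := key
  obtain ⟨x, hx, hxe⟩ := exists_odd_resType_eq hp hp2 (R + 1) e
  refine ⟨x :: L.map fun x => 2 * x, ?_, ?_⟩
  · exact hL.imp (fun h => h.cons hx) (Or.imp (fun h => h.cons hx) fun h => h.cons hx)
  · rw [he]
    simp [hxe, Function.comp_def, resType_two_mul hp hp2]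

theorem resType_zero (p R : ℕ) : resType p R 0 = (R, true) :=
  Prod.ext (resType_fst_of_dvd (dvd_zero _)) (by simp [resType])

theorem resType_prime_mul {p : ℕ} (hp : p.Prime) (hp2 : p ≠ 2) (R : ℕ) (x : ℤ) :
    resType p R (p * x) = ((resType p R x).1, true) :=
  Prod.ext (resType_odd_mul (odd_natCast_of_prime hp hp2) x) (by simp [resType])

theorem resType_two_pow {p : ℕ} (hp : p.Prime) (hp2 : p ≠ 2) {k R : ℕ} (hk : k ≤ R) :
    resType p R (2 ^ k) = (k, false) := by
  have h1 := resType_fst_of_mul (p := p) hk odd_one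
  have h2 := prime_dvd_two_pow_mul_iff hp hp2 k 1
  rw [mul_one] at h1 h2
  refine Prod.ext h1 (resType_snd_eq_false.2 ?_)
  rw [h2]
  exact fun h => hp.one_lt.ne' (by exact_mod_cast Int.eq_one_of_dvd_one (by positivity) h)

theorem resType_two_pow_mul_prime {p : ℕ} (hp : p.Prime) (hp2 : p ≠ 2) {k R : ℕ} (hk : k ≤ R) :
    resType p R (2 ^ k * p) = (k, true) := by
  rw [mul_comm, resType_prime_mul hp hp2, resType_two_pow hp hp2 hk]

/-! ### Classification of the extremal multisets -/

/-- Sequences of multiples of `p` without balanced submultiset. -/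
theorem exists_isTwoForm {n p : ℕ} (hn : Even n) (hn4 : 4 ≤ n) (hp : p.Prime) (hp2 : p ≠ 2) (R : ℕ)
    (M : Multiset ResidueType) (hM : ∀ t ∈ M, t.1 ≤ R + 1) (ht : ∀ t ∈ M, t.2 = true)
    (hc : M.card = n + R) (hbad : ¬ HasBalanced n M) :
    ∃ L, IsTwoForm n R L ∧ M = (L.map fun x => resType p (R + 1) (p * x) : List ResidueType) := by
  induction R generalizing M with
  | zero =>
    obtain ⟨a, b, M', rfl⟩ := exists_eq_withBottom M
    have hM' := le_of_mem_withBottom hM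
    have ht' : ∀ t ∈ M', t.2 = true := fun t h => ht (shiftType t) (by
      simp only [withBottom, Multiset.mem_add]
      exact Or.inr (Multiset.mem_map_of_mem _ h))
    have hb : b = 0 := by
      by_contra hb
      simpa using ht (0, false) (by simp [withBottom, Multiset.mem_replicate, hb])
    subst hb
    have hMr : M' = Multiset.replicate M'.card (0, true) :=
      Multiset.eq_replicate_card.2 fun t h => Prod.ext (Nat.le_zero.1 (hM' t h)) (ht' t h)
    rw [card_withBottom] at hc
    have hcd := countP_false_add_true M'
    have hd : M'.countP (fun t => t.2 = false) = 0 :=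
      Multiset.countP_eq_zero.2 (fun t h => by simp [ht' t h])
    have ha : Odd a := by
      by_contra ha
      rw [Nat.not_odd_iff_even] at ha
      rcases Nat.eq_zero_or_pos a with rfl | ha0
      · refine hbad (HasBalanced.withBottom ?_ 0 0)
        exact hasBalanced_of_forall_true hn hn4 0 M' hM' ht' (by omega)
      · exact hbad (hasBalanced_withBottom a 0 (M'.countP fun t => t.2 = true) 0 le_rfl le_rfl le_rfl
          (by omega) (by omega) (by omega) (by simpa using ha) (by omega))
    refine ⟨_, ⟨[], a, PrimeChain.nil, ha, by omega, rfl⟩, ?_⟩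
    have h1 := resType_prime_mul hp hp2 1 1
    rw [mul_one, resType_fst_of_odd odd_one] at h1
    rw [hMr, show M'.card = n - a by omega]
    simp only [Multiset.coe_replicate, List.nil_append, List.map_append, List.map_replicate,
      ← Multiset.coe_add, withBottom, shiftType, h1, mul_zero, resType_zero, pow_zero, mul_one]
    simp [shiftType]
  | succ R ih =>
    obtain ⟨a, b, M', rfl⟩ := exists_eq_withBottom M
    have hM' := le_of_mem_withBottom hM
    have ht' : ∀ t ∈ M', t.2 = true := fun t h => ht (shiftType t) (by
      simp only [withBottom, Multiset.mem_add]
      exact Or.inr (Multiset.mem_map_of_mem _ h))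
    rw [card_withBottom] at hc
    have hb : b = 0 := by
      by_contra hb
      simpa using ht (0, false) (by simp [withBottom, Multiset.mem_replicate, hb])
    subst hb
    have hbad' : ¬ HasBalanced n M' := fun h => hbad (h.withBottom _ _)
    have hcd := countP_false_add_true M'
    have hd : M'.countP (fun t => t.2 = false) = 0 :=
      Multiset.countP_eq_zero.2 (fun t h => by simp [ht' t h])
    have ha : a = 1 := by
      by_contra ha
      rcases Nat.eq_zero_or_pos a with rfl | ha0
      · exact hbad' (hasBalanced_of_forall_true hn hn4 (R + 1) M' hM' ht' (by omega))
      · rw [Nat.even_iff] at hn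
        refine hbad (hasBalanced_withBottom (min n (a - a % 2)) 0 (n - min n (a - a % 2)) 0
          ?_ ?_ ?_ ?_ ?_ ?_ (Nat.even_iff.2 ?_) ?_) <;> omega
    subst ha
    obtain ⟨L, hL, rfl⟩ := ih M' hM' ht' (by omega) hbad'
    refine ⟨_, hL.cons odd_one, ?_⟩
    have h1 := resType_prime_mul hp hp2 (R + 1 + 1) 1
    rw [mul_one, resType_fst_of_odd odd_one] at h1
    simp only [withBottom, List.map_cons, List.map_map, mul_one, h1, Function.comp_def,
      mul_left_comm (p : ℤ) 2, resType_two_mul hp hp2]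
    simp [Function.comp_def]

theorem eq_replicate_add_replicate {M : Multiset ResidueType} (h : ∀ t ∈ M, t.1 ≤ 0) :
    M = Multiset.replicate (M.countP fun t => t.2 = true) (0, true) +
      Multiset.replicate (M.countP fun t => t.2 = false) (0, false) := by
  have := Multiset.filter_add_not (fun t : ResidueType => t.2 = true) M
  nth_rw 1 [← this]
  simp only [Multiset.countP_eq_card_filter]
  congr 1
  · exact Multiset.eq_replicate_card.2 fun t ht =>
      Prod.ext (Nat.le_zero.1 (h t (Multiset.mem_filter.1 ht).1)) (Multiset.mem_filter.1 ht).2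
  · simp only [Bool.not_eq_true]
    exact Multiset.eq_replicate_card.2 fun t ht =>
      Prod.ext (Nat.le_zero.1 (h t (Multiset.mem_filter.1 ht).1)) (Multiset.mem_filter.1 ht).2

/-- The exceptions of `exists_bottom_counts_one` are, in turn, `(∗)` with chain `[1]`, `(∗∗)`, and
`(∗)` with chain `[2]`. In both cases of `(∗)`, `m` is the number `a` of bottom multiples of `p`. -/
theorem isExtremalTypes_one {n p : ℕ} (hn : Even n) (hn4 : 4 ≤ n) (hp : p.Prime) (hp2 : p ≠ 2)
    {a b : ℕ} {M : Multiset ResidueType} (hM : ∀ t ∈ M, t.1 ≤ 0) (hc : a + b + M.card = n + 1)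
    (hab : 2 ≤ a + b) (hbad : ¬ HasBalanced n (withBottom a b M)) :
    IsExtremalTypes n p 1 (withBottom a b M) := by
  have hcd := countP_false_add_true M
  have hMr := eq_replicate_add_replicate hM
  have r1 : resType p 1 1 = (0, false) := by simpa using resType_two_pow hp hp2 (Nat.zero_le 1)
  have r2 : resType p 1 2 = (1, false) := by simpa using resType_two_pow hp hp2 (le_refl 1)
  have rp : resType p 1 p = (0, true) := by
    simpa using resType_two_pow_mul_prime hp hp2 (Nat.zero_le 1)
  have c1 : PrimeChain (2 ^ 0 * p) [1] := by
    simpa using PrimeChain.cons hp isCoprime_one_left PrimeChain.nil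
  have c2 : PrimeChain (2 ^ 0 * p) [2] := by
    have h : IsCoprime (2 : ℤ) p := Int.isCoprime_two_left.2 (odd_natCast_of_prime hp hp2)
    simpa using PrimeChain.cons hp h PrimeChain.nil
  by_cases h1 : b = 1 ∧ M.countP (fun t => t.2 = false) = 0 ∧ Odd a
  · obtain ⟨rfl, hd, ha⟩ := h1
    refine ⟨_, Or.inr (Or.inl ⟨0, [1], a, rfl, c1, ha, by omega, rfl⟩), ?_⟩
    rw [hMr, hd, show M.countP (fun t => t.2 = true) = n - a by omega]
    simp [withBottom, shiftType, r1, rp, resType_zero]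
    simp only [← Multiset.cons_coe, ← Multiset.coe_add, ← Multiset.singleton_add, Multiset.coe_replicate]
    abel
  by_cases h2 : b = 1 ∧ a + b = n
  · obtain ⟨rfl, hn⟩ := h2
    -- Only one member lies above the bottom, and its type is free: `c = 0` or `c = 2` according to
    -- divisibility by `p`.
    obtain ⟨c, hc2, hcM⟩ : ∃ c : ℤ, 2 ∣ c ∧ M.map shiftType = {resType p 1 c} := by
      rcases Nat.eq_zero_or_pos (M.countP fun t => t.2 = false) with hd | hd
      · refine ⟨0, dvd_zero _, ?_⟩
        rw [hMr, hd, show M.countP (fun t => t.2 = true) = 1 by omega]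
        simp [resType_zero, shiftType]
      · refine ⟨2, dvd_rfl, ?_⟩
        rw [hMr, show M.countP (fun t => t.2 = true) = 0 by omega,
          show M.countP (fun t => t.2 = false) = 1 by omega]
        simp [shiftType, r2]
    refine ⟨_, Or.inr (Or.inr ⟨0, Fin.elim0, c, rfl, fun i => i.elim0, by simpa using hc2, rfl⟩), ?_⟩
    rw [withBottom, hcM, show n - 1 = a by omega]
    simp [r1, rp]
    simp only [← Multiset.cons_coe, ← Multiset.singleton_add, Multiset.coe_replicate]
    abel
  by_cases h3 : b = 0 ∧ M.countP (fun t => t.2 = false) = 1 ∧ Odd a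
  · obtain ⟨rfl, hd, ha⟩ := h3
    refine ⟨_, Or.inr (Or.inl ⟨0, [2], a, rfl, c2, ha, by omega, rfl⟩), ?_⟩
    rw [hMr, hd, show M.countP (fun t => t.2 = true) = n - a by omega]
    simp [withBottom, shiftType, r2, rp, resType_zero]
    simp only [← Multiset.cons_coe, ← Multiset.coe_add, ← Multiset.singleton_add, Multiset.coe_replicate]
    abel
  obtain ⟨a', b', c', d', h⟩ := exists_bottom_counts_one
    (c := M.countP fun t => t.2 = true) hn (by omega) hab h1 h2 h3
  exact (hbad (hasBalanced_withBottom a' b' c' d' h.1 h.2.1 h.2.2.1 h.2.2.2.1 h.2.2.2.2.1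
    h.2.2.2.2.2.1 h.2.2.2.2.2.2.1 h.2.2.2.2.2.2.2)).elim

/-- Multisets of types of length `n + R` without balanced submultiset. -/
theorem isExtremalTypes_of_not_hasBalanced {n p : ℕ} (hn : Even n) (hn4 : 4 ≤ n) (hp : p.Prime)
    (hp2 : p ≠ 2) (R : ℕ) (M : Multiset ResidueType) (hM : ∀ t ∈ M, t.1 ≤ R)
    (hc : M.card = n + R) (hbad : ¬ HasBalanced n M) : IsExtremalTypes n p R M := by
  induction R generalizing M with
  | zero =>
    have e : M.countP (fun t => t.1 = 0) = n := by
      rw [Multiset.countP_eq_card.2 (fun t h => Nat.le_zero.1 (hM t h))]; exact hc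
    have hd : M.countP (fun t => t.2 = false) = 1 := by
      by_contra hd
      exact hbad ⟨M, le_rfl, hc, ⟨0, fun _ _ => Nat.zero_le _, by omega, by rwa [e]⟩, hd⟩
    have hcd := countP_false_add_true M
    refine ⟨[1] ++ List.replicate (n - 1) 0, Or.inl ⟨[1], ?_, rfl⟩, ?_⟩
    · simpa using PrimeChain.cons hp isCoprime_one_left PrimeChain.nil
    · have r1 : resType p 0 1 = (0, false) := by simpa using resType_two_pow hp hp2 (le_refl 0)
      rw [eq_replicate_add_replicate hM, hd, show M.countP (fun t => t.2 = true) = n - 1 by omega]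
      simp [r1, resType_zero]
      simp only [← Multiset.cons_coe, ← Multiset.singleton_add, Multiset.coe_replicate]
      abel
  | succ R ih =>
    obtain ⟨a, b, M', rfl⟩ := exists_eq_withBottom M
    have hM' := le_of_mem_withBottom hM
    rw [card_withBottom] at hc
    have hbad' : ¬ HasBalanced n M' := fun h => hbad (h.withBottom _ _)
    have hcd := countP_false_add_true M'
    rcases Nat.lt_or_ge (a + b) 2 with hab | hab
    · have h1 : a + b = 1 := by
        by_contra h1
        -- With no bottom member, `M'` has `n + R + 1` members under the cap `R`, already too many.
        exact hbad' (hasBalanced_of_card_eq hn hn4 R M' hM' (by omega))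
      exact (ih M' hM' (by omega) hbad').withBottom hp hp2 h1
    · cases R with
      | zero => exact isExtremalTypes_one hn hn4 hp hp2 hM' (by omega) hab hbad
      | succ R =>
        by_cases hex : a = 1 ∧ b = 1 ∧ M'.countP (fun t => t.2 = false) = 0
        · obtain ⟨rfl, rfl, hd⟩ := hex
          -- The `n + R` higher members are multiples of `p` under the cap `R + 1`, one fewer than
          -- the 2-part bound.
          obtain ⟨L, hL, rfl⟩ := exists_isTwoForm hn hn4 hp hp2 R M' hM'
            (fun t h => by simpa using Multiset.countP_eq_zero.1 hd t h) (by omega) hbad'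
          have r1 : resType p (R + 1 + 1) 1 = (0, false) := by
            simpa using resType_two_pow hp hp2 (Nat.zero_le (R + 1 + 1))
          have rp : resType p (R + 1 + 1) p = (0, true) := by
            simpa using resType_two_pow_mul_prime hp hp2 (Nat.zero_le (R + 1 + 1))
          refine ⟨_, Or.inr (Or.inl ((hL.cons odd_one).isAstList hp (b := 1) ?_)), ?_⟩
          · exact resType_snd_eq_false.1 (congrArg Prod.snd r1)
          · simp only [withBottom, List.map_cons, List.map_map, mul_one, r1, rp, Function.comp_def,
              mul_left_comm (p : ℤ) 2, resType_two_mul hp hp2]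
            simp [Function.comp_def]
            exact List.Perm.swap _ _ _
        · obtain ⟨a', b', c', d', h⟩ := exists_bottom_counts (B := R + 2)
            (c := M'.countP fun t => t.2 = true) hn hn4 (by omega) (by omega) hab hex
          exact (hbad (hasBalanced_withBottom a' b' c' d' h.1 h.2.1 h.2.2.1 h.2.2.2.1 h.2.2.2.2.1
            h.2.2.2.2.2.1 h.2.2.2.2.2.2.1 h.2.2.2.2.2.2.2)).elim

theorem exists_primeChain_two_pow_mul {p : ℕ} (hp : p.Prime) (r : ℕ) :
    ∃ C, PrimeChain (2 ^ r * p) C := by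
  induction r with
  | zero => exact ⟨_, by simpa using PrimeChain.cons hp isCoprime_one_left PrimeChain.nil⟩
  | succ r ih =>
    obtain ⟨C, hC⟩ := ih
    exact ⟨_, by rw [pow_succ', mul_assoc]; exact hC.cons_two odd_one⟩

theorem PrimeChain.ne_zero {d : ℕ} {C : List ℤ} (h : PrimeChain d C) : d ≠ 0 := by
  induction h with
  | nil => exact one_ne_zero
  | cons hq _ _ ih => exact mul_ne_zero hq.ne_zero ih

theorem PrimeChain.length_eq {d : ℕ} {C : List ℤ} (h : PrimeChain d C) :
    C.length = ArithmeticFunction.cardFactors d := by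
  induction h with
  | nil => simp
  | cons hq _ h ih =>
    rw [ArithmeticFunction.cardFactors_mul hq.ne_zero h.ne_zero,
      ArithmeticFunction.cardFactors_apply_prime hq]
    simp [ih, add_comm]

theorem PrimeChain.length_of_two_pow_mul {p r : ℕ} (hp : p.Prime) {C : List ℤ}
    (h : PrimeChain (2 ^ r * p) C) : C.length = r + 1 := by
  rw [h.length_eq, ArithmeticFunction.cardFactors_mul (by positivity) hp.ne_zero,
    ArithmeticFunction.cardFactors_apply_prime hp,
    ArithmeticFunction.cardFactors_apply_prime_pow Nat.prime_two]

theorem primeChain_ofFn {s : ℕ} (a : Fin s → ℤ) (ha : ∀ i, Odd (a i)) :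
    PrimeChain (2 ^ s) (List.ofFn fun i : Fin s => (2 : ℤ) ^ (i : ℕ) * a i) := by
  induction s with
  | zero => simpa using PrimeChain.nil
  | succ s ih =>
    have := (ih (fun i => a i.succ) fun i => ha _).cons_two (ha 0)
    rw [pow_succ']
    simpa [List.ofFn_succ, pow_succ', mul_assoc, Function.comp_def] using this

theorem not_isBalanced_cons_of_lt {t : ResidueType} {M : Multiset ResidueType}
    (h : ∀ u ∈ M, t.1 < u.1) : ¬ IsBalanced (t ::ₘ M) := by
  rintro ⟨⟨w, h1, h2, h3⟩, -⟩
  have hwt := h1 t (Multiset.mem_cons_self _ _)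
  obtain ⟨u, hu, rfl⟩ := Multiset.countP_pos.1 h2
  rcases Multiset.mem_cons.1 hu with rfl | hu
  · rw [Multiset.countP_cons_of_pos (p := fun t : ResidueType => t.1 = u.1) _ rfl,
      Multiset.countP_eq_zero.2 (fun v hv => (h v hv).ne')] at h3
    exact absurd h3 (by decide)
  · have := h u hu
    omega

theorem not_isBalanced_cons_of_true {t : ResidueType} {M : Multiset ResidueType}
    (ht : t.2 = false) (h : ∀ u ∈ M, u.2 = true) : ¬ IsBalanced (t ::ₘ M) := by
  rintro ⟨-, h1⟩
  apply h1
  rw [Multiset.countP_cons_of_pos (p := fun t : ResidueType => t.2 = false) _ ht,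
    Multiset.countP_eq_zero.2 (fun v hv => by simp [h v hv])]

theorem le_of_le_cons {α : Type*} [DecidableEq α] {M N : Multiset α} {t : α} (h : M ≤ t ::ₘ N) :
    M ≤ N ∨ ∃ M' ≤ N, M = t ::ₘ M' := by
  by_cases ht : t ∈ M
  · exact Or.inr ⟨M.erase t, Multiset.erase_le_iff_le_cons.2 h, (Multiset.cons_erase ht).symm⟩
  · exact Or.inl ((Multiset.le_cons_of_notMem ht).1 h)

/-- All of `N` is divisible by `A * q` while `b` is prime to `q`. For `q = 2` the new term alone has
minimal valuation; for `q = p` it alone is prime to `p`. -/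
theorem not_isBalanced_cons_resType {p r q A : ℕ} (hp : p.Prime) (hp2 : p ≠ 2) (hq : q.Prime)
    (hA : A * q ∣ 2 ^ r * p) {b : ℤ} (hb : IsCoprime b (q : ℤ)) {N : List ℤ}
    (hN : ∀ z ∈ N, ((A * q : ℕ) : ℤ) ∣ z) {M : Multiset ResidueType}
    (hM : M ≤ (N.map (resType p r) : List ResidueType)) :
    ¬ IsBalanced (resType p r (A * b) ::ₘ M) := by
  have hmem : ∀ t ∈ M, ∃ z, ((A * q : ℕ) : ℤ) ∣ z ∧ resType p r z = t := fun t ht => by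
    obtain ⟨z, hz, rfl⟩ := List.mem_map.1 (Multiset.mem_coe.1 (Multiset.mem_of_le hM ht))
    exact ⟨z, hN z hz, rfl⟩
  have hA0 : A ≠ 0 := by
    rintro rfl
    have : 2 ^ r * p ≠ 0 := mul_ne_zero (by positivity) hp.ne_zero
    simp_all
  have h2p : ¬ 2 ∣ p := fun h => hp2 ((Nat.prime_dvd_prime_iff_eq Nat.prime_two hp).1 h).symm
  rcases (Nat.Prime.dvd_mul hq).1 ((Dvd.intro_left _ rfl).trans hA) with h | h
  · obtain rfl : q = 2 := (Nat.prime_dvd_prime_iff_eq hq Nat.prime_two).1 (hq.dvd_of_dvd_pow h)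
    obtain ⟨k, m, hm, rfl⟩ := Nat.exists_eq_two_pow_mul_odd hA0
    -- Without this the cap could hide the gap between valuation `k` and the later terms.
    have hk : k + 1 ≤ r := by
      have h1 : 2 ^ (k + 1) ∣ 2 ^ r * p := dvd_trans ⟨m, by ring⟩ hA
      exact (Nat.pow_dvd_pow_iff_le_right (by norm_num)).1
        ((Nat.Coprime.pow_left _ ((Nat.Prime.coprime_iff_not_dvd Nat.prime_two).2 h2p)).dvd_of_dvd_mul_right h1)
    have hl : (resType p r ((2 ^ k * m : ℕ) * b)).1 = k := by
      push_cast
      rw [mul_assoc]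
      refine resType_fst_of_mul (by omega) (Odd.mul (by exact_mod_cast hm) ?_)
      exact Int.isCoprime_two_right.1 hb
    apply not_isBalanced_cons_of_lt
    intro t ht
    obtain ⟨z, hz, rfl⟩ := hmem t ht
    rw [hl]
    refine (le_resType_fst_iff hk z).2 (dvd_trans ⟨m, ?_⟩ hz)
    push_cast
    ring
  · obtain rfl : q = p := (Nat.prime_dvd_prime_iff_eq hq hp).1 h
    apply not_isBalanced_cons_of_true
    · rw [resType_snd_eq_false]
      intro hd
      rcases (Nat.prime_iff_prime_int.1 hp).dvd_or_dvd hd with h | h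
      · have h1 : A ∣ 2 ^ r := (Nat.mul_dvd_mul_iff_right hp.pos).1 hA
        have h3 := hp.dvd_of_dvd_pow ((Int.natCast_dvd_natCast.1 h).trans h1)
        exact hp2 ((Nat.prime_dvd_prime_iff_eq hp Nat.prime_two).1 h3)
      · exact (isCoprime_natCast_iff_not_dvd hp b).1 hb h
    · intro t ht
      obtain ⟨z, hz, rfl⟩ := hmem t ht
      have : (q : ℤ) ∣ z := dvd_trans (by push_cast; exact Dvd.intro_left _ rfl) hz
      simp [resType, this]

/-- A balanced multiset contains no member of a chain all whose later terms are more divisible. -/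
theorem PrimeChain.le_of_isBalanced {p r d : ℕ} (hp : p.Prime) (hp2 : p ≠ 2) {C : List ℤ}
    (h : PrimeChain d C) (A : ℕ) (hA : A * d ∣ 2 ^ r * p) {Z : List ℤ}
    (hZ : ∀ z ∈ Z, ((A * d : ℕ) : ℤ) ∣ z) {M : Multiset ResidueType}
    (hM : M ≤ ((C.map (fun x => (A : ℤ) * x) ++ Z).map (resType p r) : List ResidueType))
    (hbal : IsBalanced M) : M ≤ (Z.map (resType p r) : List ResidueType) := by
  induction h generalizing A with
  | nil => simpa using hM
  | @cons q d b L hq hb h ih =>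
    have e : L.map (fun x => (A : ℤ) * ((q : ℤ) * x)) = L.map (fun x => ((A * q : ℕ) : ℤ) * x) := by
      simp [mul_assoc]
    rw [List.map_cons, List.cons_append, List.map_cons, List.map_map, Function.comp_def, e,
      ← Multiset.cons_coe] at hM
    rw [← mul_assoc] at hA hZ
    rcases le_of_le_cons hM with hM | ⟨M', hM', rfl⟩
    · exact ih _ hA hZ hM
    · refine (not_isBalanced_cons_resType hp hp2 hq ((Dvd.intro _ rfl).trans hA) hb ?_ hM' hbal).elim
      intro z hz
      rcases List.mem_append.1 hz with hz | hz
      · obtain ⟨x, -, rfl⟩ := List.mem_map.1 hz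
        exact Dvd.intro _ rfl
      · exact dvd_trans (by push_cast; exact Dvd.intro _ rfl) (hZ z hz)

theorem PrimeChain.hasBalanced_append {n p r d : ℕ} (hp : p.Prime) (hp2 : p ≠ 2) {C : List ℤ}
    (h : PrimeChain d C) (hA : d ∣ 2 ^ r * p) {Z : List ℤ} (hZ : ∀ z ∈ Z, (d : ℤ) ∣ z)
    (hM : HasBalanced n ((C ++ Z).map (resType p r) : List ResidueType)) :
    HasBalanced n (Z.map (resType p r) : List ResidueType) := by
  obtain ⟨M, h1, h2, h3⟩ := hM
  exact ⟨M, h.le_of_isBalanced hp hp2 1 (by simpa using hA) (by simpa using hZ)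
    (by simpa using h1) h3, h2, h3⟩

theorem HasBalanced.card_le {n : ℕ} {M : Multiset ResidueType} (h : HasBalanced n M) :
    n ≤ M.card := by
  obtain ⟨M', h1, rfl, -⟩ := h
  exact Multiset.card_le_card h1

theorem IsBalanced.even_countP {M : Multiset ResidueType} (h : IsBalanced M) {k : ℕ}
    (hk : ∀ t ∈ M, k ≤ t.1) (h0 : 0 < M.countP fun t => t.1 = k) :
    Even (M.countP fun t => t.1 = k) := by
  obtain ⟨⟨w, h1, h2, h3⟩, -⟩ := h
  obtain ⟨u, hu, rfl⟩ := Multiset.countP_pos.1 h0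
  obtain ⟨v, hv, rfl⟩ := Multiset.countP_pos.1 h2
  rwa [le_antisymm (hk v hv) (h1 u hu)]

theorem IsStarList.not_hasBalanced {n p r : ℕ} (hn : 0 < n) (hp : p.Prime) (hp2 : p ≠ 2) {L : List ℤ}
    (h : IsStarList n p r L) : L.length = n + r ∧
      ¬ HasBalanced n (L.map (resType p r) : List ResidueType) := by
  obtain ⟨C, hC, rfl⟩ := h
  refine ⟨?_, fun h => ?_⟩
  · simp [hC.length_of_two_pow_mul hp]
    omega
  · have := (hC.hasBalanced_append hp hp2 dvd_rfl
      (fun z hz => by simp [List.eq_of_mem_replicate hz]) h).card_le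
    simp at this
    omega

theorem IsAstList.not_hasBalanced {n p r : ℕ} (hp : p.Prime) (hp2 : p ≠ 2) {L : List ℤ}
    (h : IsAstList n p r L) : L.length = n + r ∧
      ¬ HasBalanced n (L.map (resType p r) : List ResidueType) := by
  obtain ⟨s, C, m, rfl, hC, hm, hmn, rfl⟩ := h
  refine ⟨?_, fun h => ?_⟩
  · simp [hC.length_of_two_pow_mul hp]
    omega
  · rw [List.append_assoc] at h
    have hdvd : 2 ^ s * p ∣ 2 ^ (s + 1) * p := ⟨2, by ring⟩
    obtain ⟨M, h1, h2, h3⟩ := hC.hasBalanced_append hp hp2 hdvd (fun z hz => by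
      rcases List.mem_append.1 hz with hz | hz <;> simp [List.eq_of_mem_replicate hz]) h
    -- The tail has exactly `n` members, so all are used, and the number `m` of minimal valuation is
    -- odd.
    obtain rfl := Multiset.eq_of_le_of_card_le h1 (by simp [h2]; omega)
    have e : Multiset.countP (fun t : ResidueType => t.1 = s) (List.map (resType p (s + 1))
        (List.replicate m ((2 : ℤ) ^ s * p) ++ List.replicate (n - m) 0) : List ResidueType) = m := by
      simp [resType_two_pow_mul_prime hp hp2 (Nat.le_succ s), resType_zero, List.countP_replicate]
    have := h3.even_countP (k := s) (by
      intro t ht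
      obtain ⟨z, hz, rfl⟩ := List.mem_map.1 (Multiset.mem_coe.1 ht)
      rcases List.mem_append.1 hz with hz | hz
      · simp [List.eq_of_mem_replicate hz, resType_two_pow_mul_prime hp hp2 (Nat.le_succ s)]
      · simp [List.eq_of_mem_replicate hz, resType_zero]) (by rw [e]; exact hm.pos)
    rw [e] at this
    exact Nat.not_even_iff_odd.2 hm this

theorem IsDoubleAstList.not_hasBalanced {n p r : ℕ} (hn : Even n) (hn4 : 4 ≤ n) (hp : p.Prime)
    (hp2 : p ≠ 2) {L : List ℤ} (h : IsDoubleAstList n p r L) : L.length = n + r ∧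
      ¬ HasBalanced n (L.map (resType p r) : List ResidueType) := by
  obtain ⟨s, a, c, rfl, ha, hc, rfl⟩ := h
  refine ⟨?_, fun h => ?_⟩
  · simp
    omega
  · rw [List.append_assoc] at h
    have hdvd : 2 ^ s ∣ 2 ^ (s + 1) * p := ⟨2 * p, by ring⟩
    obtain ⟨M, h1, h2, h3⟩ := (primeChain_ofFn a ha).hasBalanced_append hp hp2 hdvd (fun z hz => by
      push_cast
      simp only [List.cons_append, List.nil_append, List.mem_cons] at hz
      rcases hz with rfl | rfl | hz
      · exact (pow_dvd_pow 2 (Nat.le_succ s)).trans hc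
      · exact dvd_rfl
      · simp [List.eq_of_mem_replicate hz]) h
    simp only [List.cons_append, List.nil_append, List.map_cons, List.map_replicate,
      resType_two_pow_mul_prime hp hp2 (Nat.le_succ s), resType_two_pow hp hp2 (Nat.le_succ s),
      ← Multiset.cons_coe, Multiset.coe_replicate] at h1
    rcases le_of_le_cons h1 with h1 | ⟨M', hM', rfl⟩
    · obtain rfl := Multiset.eq_of_le_of_card_le h1 (by simp [h2]; omega)
      exact not_isBalanced_cons_of_true rfl
        (fun u hu => by rw [Multiset.eq_of_mem_replicate hu]) h3
    -- With `c`, of valuation `s + 1`, the other `n - 1` terms all have valuation `s`: an odd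
    -- number.
    · have hs : ∀ t ∈ M', t.1 = s := fun t ht => by
        rcases Multiset.mem_cons.1 (Multiset.mem_of_le hM' ht) with rfl | h
        · rfl
        · rw [Multiset.eq_of_mem_replicate h]
      have hcs : (resType p (s + 1) c).1 = s + 1 := resType_fst_of_dvd hc
      rw [Multiset.card_cons] at h2
      have e : (resType p (s + 1) c ::ₘ M').countP (fun t => t.1 = s) = n - 1 := by
        rw [Multiset.countP_cons_of_neg (p := fun t : ResidueType => t.1 = s) _ (by simp [hcs]),
          Multiset.countP_eq_card.2 hs]
        omega
      have := h3.even_countP (k := s) (by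
        intro t ht
        rcases Multiset.mem_cons.1 ht with rfl | ht
        · omega
        · exact (hs t ht).ge) (by omega)
      rw [e] at this
      rw [Nat.even_iff] at this hn
      omega

theorem not_hasBalanced_of_isExtremalTypes {n p r : ℕ} (hn : Even n) (hn4 : 4 ≤ n) (hp : p.Prime)
    (hp2 : p ≠ 2) {M : Multiset ResidueType} (h : IsExtremalTypes n p r M) :
    M.card = n + r ∧ ¬ HasBalanced n M := by
  obtain ⟨L, h | h | h, rfl⟩ := h
  · simpa using h.not_hasBalanced (by omega) hp hp2
  · simpa using h.not_hasBalanced hp hp2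
  · simpa using h.not_hasBalanced hn hn4 hp hp2

/-! ### Weighted zero-sums in terms of types -/

theorem exists_le_map_eq {α β : Type*} {f : α → β} {s : Multiset α} {M : Multiset β}
    (h : M ≤ s.map f) : ∃ t ≤ s, t.map f = M := by
  induction s using Quotient.inductionOn with
  | h l =>
    induction M using Quotient.inductionOn with
    | h m =>
      obtain ⟨l', hl', hsub⟩ := (Multiset.coe_le.1 h : m.Subperm (l.map f))
      obtain ⟨l'', hl'', rfl⟩ := List.sublist_map_iff.1 hsub
      exact ⟨l'', hl''.subperm, by simpa using hl'⟩

theorem Int.even_sum_iff_even_card_odd {ι : Type*} (I : Finset ι) (f : ι → ℤ) :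
    Even (∑ i ∈ I, f i) ↔ Even (I.filter fun i => Odd (f i)).card := by
  classical
  induction I using Finset.induction with
  | empty => simp
  | insert a I ha ih =>
    rw [Finset.sum_insert ha, Finset.filter_insert, Int.even_add, ih]
    split_ifs with h
    · rw [Finset.card_insert_of_notMem (by simp [ha]), Nat.even_add_one]
      simp [Int.not_even_iff_odd.2 h]
    · simp [Int.not_odd_iff_even.1 h]

theorem isCoprime_two_pow_natCast {p : ℕ} (hp : p.Prime) (hp2 : p ≠ 2) (r : ℕ) :
    IsCoprime ((2 : ℤ) ^ r) (p : ℤ) :=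
  (Int.isCoprime_two_left.2 (odd_natCast_of_prime hp hp2)).pow_left

theorem isUnit_intCast_iff {r p n : ℕ} (hr : 0 < r) (hp : p.Prime) (hn : n = 2 ^ r * p) (c : ℤ) :
    IsUnit (c : ZMod n) ↔ Odd c ∧ ¬ (p : ℤ) ∣ c := by
  rw [ZMod.coe_int_isUnit_iff_isCoprime, hn]
  push_cast
  rw [IsCoprime.mul_left_iff, IsCoprime.pow_left_iff hr, Int.isCoprime_two_left, isCoprime_comm,
    isCoprime_natCast_iff_not_dvd hp]

theorem exists_unit_of_odd_of_not_dvd {r p n : ℕ} (hr : 0 < r) (hp : p.Prime) (hp2 : p ≠ 2)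
    (hn : n = 2 ^ r * p) {a b : ℤ} (ha : Odd a) (hb : ¬ (p : ℤ) ∣ b) :
    ∃ c : ℤ, IsUnit (c : ZMod n) ∧ (2 : ℤ) ^ r ∣ c - a ∧ (p : ℤ) ∣ c - b := by
  obtain ⟨s, t, h⟩ := isCoprime_two_pow_natCast hp hp2 r
  have h1 : (2 : ℤ) ^ r ∣ (a * (t * p) + b * (s * 2 ^ r)) - a :=
    ⟨b * s - a * s, by linear_combination a * h⟩
  have h2 : (p : ℤ) ∣ (a * (t * p) + b * (s * 2 ^ r)) - b :=
    ⟨a * t - b * t, by linear_combination b * h⟩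
  refine ⟨_, (isUnit_intCast_iff hr hp hn _).2 ⟨?_, ?_⟩, h1, h2⟩
  · have h3 := (even_iff_two_dvd.2 ((dvd_pow_self 2 hr.ne').trans h1)).add_odd ha
    rwa [sub_add_cancel] at h3
  · intro h3
    exact hb (by simpa using dvd_sub h3 h2)

theorem intCast_eq_zero_of_dvd {r p n : ℕ} (hp : p.Prime) (hp2 : p ≠ 2) (hn : n = 2 ^ r * p) {z : ℤ}
    (h2 : (2 : ℤ) ^ r ∣ z) (h3 : (p : ℤ) ∣ z) : (z : ZMod n) = 0 := by
  rw [ZMod.intCast_zmod_eq_zero_iff_dvd, hn]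
  push_cast
  exact (isCoprime_two_pow_natCast hp hp2 r).mul_dvd h2 h3

theorem exists_odd_mul_sub_dvd {y t : ℤ} (hy : Odd y) (ht : Odd t) {r : ℕ} (hr : 0 < r) :
    ∃ u : ℤ, Odd u ∧ (2 : ℤ) ^ r ∣ u * y - t := by
  obtain ⟨s, v, h⟩ := (Int.isCoprime_two_left.2 hy).pow_left (m := r)
  refine ⟨t * v, ht.mul ?_, -(t * s), by linear_combination t * h⟩
  by_contra hv
  have h1 : Even (s * 2 ^ r + v * y) :=
    ((even_two.pow_of_ne_zero hr.ne').mul_left s).add ((Int.not_odd_iff_even.1 hv).mul_right y)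
  rw [h] at h1
  exact absurd h1 (by decide)

theorem exists_not_dvd_mul_sub_dvd {p : ℕ} (hp : p.Prime) {y t : ℤ} (hy : ¬ (p : ℤ) ∣ y)
    (ht : ¬ (p : ℤ) ∣ t) : ∃ u : ℤ, ¬ (p : ℤ) ∣ u ∧ (p : ℤ) ∣ u * y - t := by
  obtain ⟨v, s, h⟩ := (isCoprime_natCast_iff_not_dvd hp y).2 hy
  refine ⟨t * v, fun hd => ?_, -(t * s), by linear_combination t * h⟩
  apply ht
  have h1 : t = t * v * y + t * s * p := by linear_combination -t * h
  rw [h1]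
  exact dvd_add (hd.mul_right _) (Dvd.intro_left _ rfl)

/-- Residues of equal type differ by a unit. -/
theorem exists_unit_mul_eq {r p n : ℕ} (hr : 0 < r) (hp : p.Prime) (hp2 : p ≠ 2)
    (hn : n = 2 ^ r * p) {x y : ℤ} (h : resType p r x = resType p r y) :
    ∃ u : ZMod n, IsUnit u ∧ (y : ZMod n) = u * x := by
  obtain ⟨a, ha, hax⟩ : ∃ a : ℤ, Odd a ∧ (2 : ℤ) ^ r ∣ a * x - y := by
    obtain ⟨x', hx, hxo⟩ := exists_two_pow_mul (p := p) (R := r) x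
    obtain ⟨y', hy, hyo⟩ := exists_two_pow_mul (p := p) (R := r) y
    rw [← h] at hy hyo
    rcases (resType_fst_le p r x).lt_or_eq with hlt | heq
    · obtain ⟨a, ha, hd⟩ := exists_odd_mul_sub_dvd (hxo hlt) (hyo hlt) hr
      refine ⟨a, ha, ?_⟩
      have e : a * x - y = 2 ^ (resType p r x).1 * (a * x' - y') := by
        linear_combination a * hx - hy
      rw [e]
      exact hd.mul_left _
    · rw [heq] at hx hy
      exact ⟨1, odd_one, x' - y', by linear_combination hx - hy⟩
  obtain ⟨b, hb, hbx⟩ : ∃ b : ℤ, ¬ (p : ℤ) ∣ b ∧ (p : ℤ) ∣ b * x - y := by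
    have h2 : (p : ℤ) ∣ x ↔ (p : ℤ) ∣ y := by
      simpa [resType] using congrArg Prod.snd h
    by_cases hx : (p : ℤ) ∣ x
    · refine ⟨1, fun h => hp.one_lt.ne' ?_, by simpa using dvd_sub hx (h2.1 hx)⟩
      exact_mod_cast Int.eq_one_of_dvd_one (by positivity) h
    · exact exists_not_dvd_mul_sub_dvd hp hx (mt h2.2 hx)
  obtain ⟨c, hc, h1, h2⟩ := exists_unit_of_odd_of_not_dvd hr hp hp2 hn ha hb
  refine ⟨c, hc, ?_⟩
  have := intCast_eq_zero_of_dvd hp hp2 hn (z := c * x - y)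
    (by simpa [sub_mul] using dvd_add (h1.mul_right x) hax)
    (by simpa [sub_mul] using dvd_add (h2.mul_right x) hbx)
  push_cast at this
  exact (sub_eq_zero.1 this).symm

theorem countP_map_val {ι : Type*} (I : Finset ι) (f : ι → ResidueType) (P : ResidueType → Prop)
    [DecidablePred P] : (I.val.map f).countP P = (I.filter fun i => P (f i)).card := by
  rw [Multiset.countP_map]; rfl

/-- Weights 1 suffice except at one index `i₀` of minimal valuation `w`. After division by `2 ^ w`
the other terms have odd sum, so the odd term at `i₀` can be scaled to cancel it modulo `2 ^ r`. If
`w = r` every term vanishes. -/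
theorem exists_odd_weights {ι : Type*} {r p : ℕ} (hr : 0 < r) (I : Finset ι) (x : ι → ℤ)
    (h : IsBalanced (I.val.map fun i => resType p r (x i))) :
    ∃ a : ι → ℤ, (∀ i, Odd (a i)) ∧ (2 : ℤ) ^ r ∣ ∑ i ∈ I, a i * x i := by
  classical
  obtain ⟨⟨w, h1, h2, h3⟩, -⟩ := h
  rw [countP_map_val] at h2 h3
  have h1' : ∀ i ∈ I, w ≤ (resType p r (x i)).1 := fun i hi =>
    h1 _ (Multiset.mem_map_of_mem (fun i => resType p r (x i)) hi)
  obtain ⟨i₀, hi₀⟩ := Finset.card_pos.1 h2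
  obtain ⟨hi₀, hw₀⟩ := Finset.mem_filter.1 hi₀
  have hwr : w ≤ r := hw₀ ▸ resType_fst_le p r (x i₀)
  have hdvd : ∀ i ∈ I, (2 : ℤ) ^ w ∣ x i := fun i hi => (le_resType_fst_iff hwr _).1 (h1' i hi)
  rcases hwr.lt_or_eq with hlt | rfl
  · have hy : ∀ i, ∃ y, i ∈ I → x i = 2 ^ w * y := fun i => by
      by_cases hi : i ∈ I
      · obtain ⟨y, hy⟩ := hdvd i hi
        exact ⟨y, fun _ => hy⟩
      · exact ⟨0, fun h => (hi h).elim⟩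
    choose y hy using hy
    have hodd : ∀ i ∈ I, ((resType p r (x i)).1 = w ↔ Odd (y i)) := fun i hi => by
      constructor
      · intro h
        by_contra ho
        obtain ⟨z, hz⟩ := even_iff_two_dvd.1 (Int.not_odd_iff_even.1 ho)
        have : w + 1 ≤ (resType p r (x i)).1 :=
          (le_resType_fst_iff hlt _).2 ⟨z, by rw [hy i hi, hz, pow_succ, mul_assoc]⟩
        omega
      · intro h
        rw [hy i hi]
        exact resType_fst_of_mul hwr h
    rw [Finset.filter_congr hodd, ← Int.even_sum_iff_even_card_odd,
      ← Finset.add_sum_erase _ _ hi₀] at h3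
    have hy₀ := (hodd i₀ hi₀).1 hw₀
    have ht : Odd (-∑ i ∈ I.erase i₀, y i) := by
      rw [odd_neg]
      exact Int.not_even_iff_odd.1 fun h =>
        Int.not_even_iff_odd.2 (hy₀.add_even h) h3
    obtain ⟨u, hu, hd⟩ := exists_odd_mul_sub_dvd hy₀ ht hr
    refine ⟨Function.update 1 i₀ u, fun i => ?_, ?_⟩
    · rcases eq_or_ne i i₀ with rfl | hne
      · simpa using hu
      · simp [hne]
    · rw [← Finset.add_sum_erase _ _ hi₀]
      have e : ∑ i ∈ I.erase i₀, Function.update (1 : ι → ℤ) i₀ u i * x i =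
          2 ^ w * ∑ i ∈ I.erase i₀, y i := by
        rw [Finset.mul_sum]
        refine Finset.sum_congr rfl fun i hi => ?_
        rw [Finset.mem_erase] at hi
        simp [hi.1, hy i hi.2]
      rw [e, Function.update_self, hy i₀ hi₀]
      have e2 : u * (2 ^ w * y i₀) + 2 ^ w * ∑ i ∈ I.erase i₀, y i =
        2 ^ w * (u * y i₀ - -∑ i ∈ I.erase i₀, y i) := by ring
      rw [e2]
      exact hd.mul_left _
  · exact ⟨fun _ => 1, fun _ => odd_one, Finset.dvd_sum fun i hi => (hdvd i hi).mul_left _⟩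

/-- Given two terms prime to `p`, the weight of one keeps the partial sum nonzero modulo `p`, and
the weight of the other then cancels it; all remaining weights are 1. -/
theorem exists_not_dvd_weights {ι : Type*} {r p : ℕ} (hp : p.Prime) (hp2 : p ≠ 2) (I : Finset ι)
    (x : ι → ℤ) (h : IsBalanced (I.val.map fun i => resType p r (x i))) :
    ∃ a : ι → ℤ, (∀ i, ¬ (p : ℤ) ∣ a i) ∧ (p : ℤ) ∣ ∑ i ∈ I, a i * x i := by
  classical
  have h1 := h.2
  rw [countP_map_val] at h1
  simp only [resType_snd_eq_false] at h1
  have hp1 : ¬ (p : ℤ) ∣ 1 := fun h => hp.one_lt.ne'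
    (by exact_mod_cast Int.eq_one_of_dvd_one (by positivity) h)
  have hp2' : ¬ (p : ℤ) ∣ 2 := fun h =>
    hp2 ((Nat.prime_dvd_prime_iff_eq hp Nat.prime_two).1 (by exact_mod_cast h))
  rcases Nat.eq_zero_or_pos (I.filter fun i => ¬ (p : ℤ) ∣ x i).card with h0 | h0
  · rw [Finset.card_eq_zero, Finset.filter_eq_empty_iff] at h0
    refine ⟨fun _ => 1, fun _ => hp1, Finset.dvd_sum fun i hi => ?_⟩
    exact (not_not.1 (h0 hi)).mul_left _
  · obtain ⟨i, hi, j, hj, hij⟩ := Finset.one_lt_card.1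
      (show 1 < (I.filter fun i => ¬ (p : ℤ) ∣ x i).card by omega)
    rw [Finset.mem_filter] at hi hj
    have hj' : j ∈ I.erase i := Finset.mem_erase.2 ⟨hij.symm, hj.1⟩
    set t := ∑ k ∈ (I.erase i).erase j, x k with ht
    -- One of `v = 1`, `v = 2` works: if both failed, `p` would divide the difference `x j`.
    obtain ⟨v, hv, hvt⟩ : ∃ v : ℤ, ¬ (p : ℤ) ∣ v ∧ ¬ (p : ℤ) ∣ -(v * x j + t) := by
      by_contra! hcon
      have c1 := hcon 1 hp1
      have c2 := hcon 2 hp2'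
      apply hj.2
      have := dvd_sub c1 c2
      ring_nf at this
      simpa using this
    obtain ⟨u, hu, hd⟩ := exists_not_dvd_mul_sub_dvd hp hi.2 hvt
    refine ⟨Function.update (Function.update 1 j v) i u, fun k => ?_, ?_⟩
    · rcases eq_or_ne k i with rfl | hki
      · simpa using hu
      · rcases eq_or_ne k j with rfl | hkj
        · simpa [hki] using hv
        · simpa [hki, hkj] using hp1
    · rw [← Finset.add_sum_erase _ _ hi.1, ← Finset.add_sum_erase _ _ hj']
      have e : ∑ k ∈ (I.erase i).erase j,
          Function.update (Function.update (1 : ι → ℤ) j v) i u k * x k = t := by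
        rw [ht]
        refine Finset.sum_congr rfl fun k hk => ?_
        simp only [Finset.mem_erase] at hk
        simp [hk.1, hk.2.1]
      rw [e]
      simp only [Function.update_self, Function.update_of_ne hij.symm]
      have e2 : u * x i + (v * x j + t) = u * x i - -(v * x j + t) := by ring
      rw [e2]
      exact hd

/-- Unit-weighted zero-sums are recognised by types. -/
theorem exists_unit_weights_iff {ι : Type*} {r p n : ℕ} (hr : 0 < r) (hp : p.Prime) (hp2 : p ≠ 2)
    (hn : n = 2 ^ r * p) (I : Finset ι) (x : ι → ℤ) (hI : I.Nonempty) (hIe : Even I.card) :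
    (∃ a : ι → ZMod n, (∀ i ∈ I, IsUnit (a i)) ∧ ∑ i ∈ I, a i * (x i : ZMod n) = 0) ↔
      IsBalanced (I.val.map fun i => resType p r (x i)) := by
  classical
  constructor
  · rintro ⟨a, ha, hsum⟩
    choose c hc using fun i => ZMod.intCast_surjective (a i)
    obtain rfl : (fun i => (c i : ZMod n)) = a := funext hc
    have hu : ∀ i ∈ I, Odd (c i) ∧ ¬ (p : ℤ) ∣ c i := fun i hi =>
      (isUnit_intCast_iff hr hp hn _).1 (ha i hi)
    have hd : (n : ℤ) ∣ ∑ i ∈ I, c i * x i := by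
      rw [← ZMod.intCast_zmod_eq_zero_iff_dvd]
      push_cast
      exact hsum
    rw [hn] at hd
    push_cast at hd
    have hd2 := (Dvd.intro _ rfl).trans hd
    have hdp := (Dvd.intro_left _ rfl).trans hd
    constructor
    · obtain ⟨i₀, hi₀, hmin⟩ := Finset.exists_min_image I (fun i => (resType p r (x i)).1) hI
      set w := (resType p r (x i₀)).1 with hw
      have hwr : w ≤ r := resType_fst_le _ _ _
      refine ⟨w, ?_, ?_, ?_⟩
      · intro t ht
        obtain ⟨i, hi, rfl⟩ := Multiset.mem_map.1 ht
        exact hmin i hi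
      · exact Multiset.countP_pos.2 ⟨_, Multiset.mem_map_of_mem _ hi₀, rfl⟩
      · rw [countP_map_val]
        rcases hwr.lt_or_eq with hlt | heq
        · have hy : ∀ i, ∃ y, i ∈ I → x i = 2 ^ w * y := fun i => by
            by_cases hi : i ∈ I
            · obtain ⟨y, hy⟩ := (le_resType_fst_iff hwr _).1 (hmin i hi)
              exact ⟨y, fun _ => hy⟩
            · exact ⟨0, fun h => (hi h).elim⟩
          choose y hy using hy
          have hodd : ∀ i ∈ I, ((resType p r (x i)).1 = w ↔ Odd (c i * y i)) := fun i hi => by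
            rw [Int.odd_mul, and_iff_right (hu i hi).1]
            constructor
            · intro h
              by_contra ho
              obtain ⟨z, hz⟩ := even_iff_two_dvd.1 (Int.not_odd_iff_even.1 ho)
              have : w + 1 ≤ (resType p r (x i)).1 :=
                (le_resType_fst_iff hlt _).2 ⟨z, by rw [hy i hi, hz, pow_succ, mul_assoc]⟩
              omega
            · intro h
              rw [hy i hi]
              exact resType_fst_of_mul hwr h
          rw [Finset.filter_congr hodd, ← Int.even_sum_iff_even_card_odd, even_iff_two_dvd]
          have e : ∑ i ∈ I, c i * x i = 2 ^ w * ∑ i ∈ I, c i * y i := by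
            rw [Finset.mul_sum]
            refine Finset.sum_congr rfl fun i hi => ?_
            rw [hy i hi]
            ring
          rw [e] at hd2
          have := (pow_dvd_pow 2 hlt).trans hd2
          rw [pow_succ] at this
          exact (mul_dvd_mul_iff_left (pow_ne_zero w two_ne_zero)).1 this
        -- For `w = r` every index has minimal valuation, and evenness is that of `I.card`.
        · rwa [Finset.filter_true_of_mem]
          intro i hi
          exact le_antisymm ((resType_fst_le _ _ _).trans heq.ge) (hmin i hi)
    · rw [countP_map_val]
      simp only [resType_snd_eq_false]
      intro h1
      obtain ⟨i₀, hi₀⟩ := Finset.card_eq_one.1 h1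
      have hmem : i₀ ∈ I.filter fun i => ¬ (p : ℤ) ∣ x i := by rw [hi₀]; simp
      rw [Finset.mem_filter] at hmem
      rw [← Finset.add_sum_erase _ _ hmem.1, dvd_add_left] at hdp
      · rcases (Nat.prime_iff_prime_int.1 hp).dvd_or_dvd hdp with h | h
        · exact (hu i₀ hmem.1).2 h
        · exact hmem.2 h
      · refine Finset.dvd_sum fun i hi => Dvd.dvd.mul_left ?_ _
        by_contra hpi
        rw [Finset.mem_erase] at hi
        have : i ∈ I.filter fun i => ¬ (p : ℤ) ∣ x i := Finset.mem_filter.2 ⟨hi.2, hpi⟩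
        rw [hi₀, Finset.mem_singleton] at this
        exact hi.1 this
  · intro h
    obtain ⟨a, ha, had⟩ := exists_odd_weights hr I x h
    obtain ⟨b, hb, hbd⟩ := exists_not_dvd_weights hp hp2 I x h
    choose c hc hca hcb using fun i => exists_unit_of_odd_of_not_dvd hr hp hp2 hn (ha i) (hb i)
    refine ⟨fun i => c i, fun i _ => hc i, ?_⟩
    have e : ∀ (d : ℤ) (a : ι → ℤ), (∀ i, d ∣ c i - a i) → d ∣ ∑ i ∈ I, a i * x i →
        d ∣ ∑ i ∈ I, c i * x i := fun d a h1 h2 => by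
      have : ∑ i ∈ I, c i * x i = ∑ i ∈ I, (c i - a i) * x i + ∑ i ∈ I, a i * x i := by
        rw [← Finset.sum_add_distrib]
        exact Finset.sum_congr rfl fun i _ => by ring
      rw [this]
      exact dvd_add (Finset.dvd_sum fun i _ => (h1 i).mul_right _) h2
    have := intCast_eq_zero_of_dvd hp hp2 hn (e _ a hca had) (e _ b hcb hbd)
    push_cast at this
    exact this

/-! ### Types of residues and equivalence of sequences -/

/-- The type of a residue modulo `n = 2 ^ r * p`. -/
noncomputable def zmodType (p r : ℕ) {n : ℕ} (x : ZMod n) : ResidueType :=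
  resType p r (x.val : ℤ)

theorem resType_eq_of_dvd_sub {p r : ℕ} {x y : ℤ} (h : ((2 ^ r * p : ℕ) : ℤ) ∣ x - y) :
    resType p r x = resType p r y := by
  push_cast at h
  have h2 : ∀ k ≤ r, ((2 : ℤ) ^ k ∣ x ↔ (2 : ℤ) ^ k ∣ y) := fun k hk =>
    (dvd_iff_dvd_of_dvd_sub (((pow_dvd_pow 2 hk).mul_right _).trans h))
  have hp : (p : ℤ) ∣ x ↔ (p : ℤ) ∣ y := dvd_iff_dvd_of_dvd_sub ((Dvd.intro_left _ rfl).trans h)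
  refine Prod.ext ?_ (by simp [resType, hp])
  apply le_antisymm
  · rw [le_resType_fst_iff (resType_fst_le _ _ _), ← h2 _ (resType_fst_le _ _ _),
      ← le_resType_fst_iff (p := p) (resType_fst_le _ _ _)]
  · rw [le_resType_fst_iff (resType_fst_le _ _ _), h2 _ (resType_fst_le _ _ _),
      ← le_resType_fst_iff (p := p) (resType_fst_le _ _ _)]

theorem zmodType_intCast {p r n : ℕ} (hp : p.Prime) (hn : n = 2 ^ r * p) (z : ℤ) :
    zmodType p r (z : ZMod n) = resType p r z := by
  have : NeZero n := ⟨by rw [hn]; exact mul_ne_zero (by positivity) hp.ne_zero⟩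
  apply resType_eq_of_dvd_sub
  rw [← hn, ← ZMod.intCast_zmod_eq_zero_iff_dvd]
  simp

theorem intCast_val_eq {n : ℕ} [NeZero n] (x : ZMod n) : (((x.val : ℕ) : ℤ) : ZMod n) = x := by
  simp

/-- The multiset of types of a sequence. -/
noncomputable def seqTypes (p r : ℕ) {n : ℕ} (S : List (ZMod n)) : Multiset ResidueType :=
  (S.map (zmodType p r) : List ResidueType)

theorem seqTypes_eq_map_univ (p r : ℕ) {n : ℕ} (S : List (ZMod n)) :
    seqTypes p r S = (Finset.univ : Finset (Fin S.length)).val.map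
      fun i => zmodType p r (S.get i) := by
  rw [Fin.univ_val_map, seqTypes]
  congr 1
  conv_lhs => rw [← List.ofFn_get S, List.map_ofFn]
  rfl

theorem hasWeightedZeroSumSubseq_iff {r p n : ℕ} (hr : 0 < r) (hp : p.Prime) (hp2 : p ≠ 2)
    (hn : n = 2 ^ r * p) (hne : Even n) (S : List (ZMod n)) :
    HasWeightedZeroSumSubseq (unitWeights n) S n ↔ HasBalanced n (seqTypes p r S) := by
  have hn0 : n ≠ 0 := by rw [hn]; exact mul_ne_zero (by positivity) hp.ne_zero
  have : NeZero n := ⟨hn0⟩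
  have key : ∀ I : Finset (Fin S.length), I.card = n →
      ((∃ a : Fin S.length → ZMod n, (∀ i ∈ I, IsUnit (a i)) ∧ ∑ i ∈ I, a i * S.get i = 0) ↔
        IsBalanced (I.val.map fun i => zmodType p r (S.get i))) := fun I hI => by
    have h := exists_unit_weights_iff hr hp hp2 hn I (fun i => ((S.get i).val : ℤ))
      (Finset.card_pos.1 (by omega)) (hI.symm ▸ hne)
    simp only [intCast_val_eq] at h
    exact h
  rw [seqTypes_eq_map_univ]
  constructor
  · rintro ⟨I, -, hI, a, ha⟩
    exact ⟨_, Multiset.map_le_map (Finset.val_le_iff.2 (Finset.subset_univ I)), by simpa using hI,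
      (key I hI).1 ⟨a, ha⟩⟩
  · rintro ⟨M, hM, hc, hb⟩
    obtain ⟨t, ht, rfl⟩ := exists_le_map_eq hM
    have hI : (⟨t, Multiset.nodup_of_le ht Finset.univ.nodup⟩ : Finset (Fin S.length)).card = n := by
      simpa using hc
    obtain ⟨a, ha⟩ := (key _ hI).2 hb
    exact ⟨_, Finset.card_pos.1 (by omega), hI, a, ha⟩

/-- Each value has fibres of equal size under `f` and `g`; bijections between the fibres glue to
`σ`. -/
theorem exists_equiv_of_map_univ_eq {α β γ : Type*} [Fintype α] [Fintype β] {f : α → γ} {g : β → γ}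
    (h : (Finset.univ : Finset α).val.map f = (Finset.univ : Finset β).val.map g) :
    ∃ σ : α ≃ β, ∀ a, g (σ a) = f a := by
  classical
  have e : ∀ c, Nonempty ({a // f a = c} ≃ {b // g b = c}) := fun c => by
    rw [← Fintype.card_eq, Fintype.card_subtype, Fintype.card_subtype]
    have := congrArg (Multiset.count c) h
    rw [Multiset.count_map, Multiset.count_map] at this
    simp only [eq_comm (a := c)] at this
    exact this
  exact ⟨Equiv.ofFiberEquiv fun c => (e c).some, fun a => Equiv.ofFiberEquiv_map _ a⟩

theorem zmodType_unit_mul {r p n : ℕ} (hr : 0 < r) (hp : p.Prime)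
    (hn : n = 2 ^ r * p) {u : ZMod n} (hu : IsUnit u) (x : ZMod n) :
    zmodType p r (u * x) = zmodType p r x := by
  obtain ⟨u, rfl⟩ := ZMod.intCast_surjective u
  obtain ⟨x, rfl⟩ := ZMod.intCast_surjective x
  obtain ⟨h1, h2⟩ := (isUnit_intCast_iff hr hp hn u).1 hu
  rw [← Int.cast_mul, zmodType_intCast hp hn, zmodType_intCast hp hn]
  refine Prod.ext (resType_odd_mul h1 x) ?_
  simp [resType, (Nat.prime_iff_prime_int.1 hp).dvd_mul, h2]

/-- The global unit `c` adds nothing to the individual unit weights, so it may be taken to be 1. -/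
theorem weightEquivalent_iff {r p n : ℕ} (hr : 0 < r) (hp : p.Prime) (hp2 : p ≠ 2)
    (hn : n = 2 ^ r * p) (S T : List (ZMod n)) :
    WeightEquivalent (unitWeights n) S T ↔ seqTypes p r S = seqTypes p r T := by
  have : NeZero n := ⟨by rw [hn]; exact mul_ne_zero (by positivity) hp.ne_zero⟩
  rw [seqTypes_eq_map_univ, seqTypes_eq_map_univ]
  constructor
  · rintro ⟨c, σ, a, hc, ha, h⟩
    have e : (fun i => zmodType p r (S.get i)) = (fun j => zmodType p r (T.get j)) ∘ σ := by
      funext i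
      rw [Function.comp_apply, ← zmodType_unit_mul hr hp hn (ha i), ← h,
        zmodType_unit_mul hr hp hn hc]
    rw [e, ← Multiset.map_map]
    congr 1
    simp
  · intro h
    obtain ⟨σ, hσ⟩ := exists_equiv_of_map_univ_eq h
    choose a ha hae using fun i => exists_unit_mul_eq hr hp hp2 hn (hσ i).symm
    refine ⟨1, σ, a, isUnit_one, ha, fun i => ?_⟩
    simpa only [intCast_val_eq, one_mul] using hae i

theorem seqTypes_map_intCast {p r n : ℕ} (hp : p.Prime) (hn : n = 2 ^ r * p) (L : List ℤ) :
    seqTypes p r (L.map fun z : ℤ => (z : ZMod n)) = (L.map (resType p r) : List ResidueType) := by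
  simp [seqTypes, Function.comp_def, zmodType_intCast hp hn]

theorem card_seqTypes (p r : ℕ) {n : ℕ} (S : List (ZMod n)) : (seqTypes p r S).card = S.length := by
  simp [seqTypes]

theorem fst_le_of_mem_seqTypes {p r n : ℕ} {S : List (ZMod n)} :
    ∀ t ∈ seqTypes p r S, t.1 ≤ r := by
  intro t ht
  obtain ⟨x, -, rfl⟩ := List.mem_map.1 (Multiset.mem_coe.1 ht)
  exact resType_fst_le _ _ _

/-! ### The Gao constant -/

/-- The value of the Gao constant for the weights `U(n)`, when `n = 2 ^ r * p`. -/
theorem gaoConstant_unitWeights {r p n : ℕ} (hr : 0 < r) (hp : p.Prime) (hp2 : p ≠ 2)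
    (hn : n = 2 ^ r * p) (hne : Even n) (hn4 : 4 ≤ n) :
    gaoConstant (unitWeights n) = n + r + 1 := by
  unfold gaoConstant
  rw [Nat.card_zmod]
  apply le_antisymm
  · refine Nat.sInf_le ⟨Nat.succ_pos _, fun S hS => ?_⟩
    rw [hasWeightedZeroSumSubseq_iff hr hp hp2 hn hne]
    exact hasBalanced_of_card_eq hne hn4 r _ fst_le_of_mem_seqTypes (by rw [card_seqTypes, hS])
  · refine le_csInf ⟨n + r + 1, Nat.succ_pos _, fun S hS => ?_⟩ ?_
    · rw [hasWeightedZeroSumSubseq_iff hr hp hp2 hn hne]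
      exact hasBalanced_of_card_eq hne hn4 r _ fst_le_of_mem_seqTypes (by rw [card_seqTypes, hS])
    · rintro k ⟨-, hk⟩
      by_contra hlt
      obtain ⟨C, hC⟩ := exists_primeChain_two_pow_mul hp r
      have hL : IsStarList n p r (C ++ List.replicate (n - 1) 0) := ⟨C, hC, rfl⟩
      generalize C ++ List.replicate (n - 1) 0 = L at hL
      obtain ⟨hlen, hbad⟩ := hL.not_hasBalanced (by omega) hp hp2
      -- The infimum requires excluding every `k ≤ n + r`, so a list `(⋆)` of length `n + r` is
      -- truncated to its first `k` terms.
      have h := hk ((L.take k).map fun z : ℤ => (z : ZMod n)) (by simp; omega)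
      rw [hasWeightedZeroSumSubseq_iff hr hp hp2 hn hne, seqTypes_map_intCast hp hn] at h
      refine hbad (h.mono ?_)
      exact ((List.take_sublist k L).map _).subperm

/-! ### Matching the stated forms with the integer lists -/

theorem prod_Iio_zero_fin {k : ℕ} (q : Fin (k + 1) → ℕ) :
    ∏ j ∈ Finset.Iio (0 : Fin (k + 1)), (q j : ℤ) = 1 := by
  have : Finset.Iio (0 : Fin (k + 1)) = ∅ := by ext; simp
  rw [this, Finset.prod_empty]

theorem prod_Iio_succ_fin {k : ℕ} (q : Fin (k + 1) → ℕ) (i : Fin k) :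
    ∏ j ∈ Finset.Iio i.succ, (q j : ℤ) = q 0 * ∏ j ∈ Finset.Iio i, (q j.succ : ℤ) := by
  have h : ∀ (m : ℕ) (l : Fin m), Finset.Iio l = Finset.univ.filter (· < l) := fun m l => by
    ext; simp
  rw [h, h, Finset.prod_filter, Finset.prod_filter, Fin.prod_univ_succ]
  simp

theorem ofFn_prod_Iio_succ {k : ℕ} (q : Fin (k + 1) → ℕ) (b : Fin (k + 1) → ℤ) :
    (List.ofFn fun i => (∏ j ∈ Finset.Iio i, (q j : ℤ)) * b i) = b 0 ::
      (List.ofFn fun i : Fin k => (∏ j ∈ Finset.Iio i, (q j.succ : ℤ)) * b i.succ).map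
        fun x => (q 0 : ℤ) * x := by
  rw [List.ofFn_succ, prod_Iio_zero_fin, one_mul, List.map_ofFn]
  simp only [prod_Iio_succ_fin, Function.comp_def, mul_assoc]

theorem primeChain_iff {d : ℕ} {C : List ℤ} : PrimeChain d C ↔
    ∃ (k : ℕ) (q : Fin k → ℕ) (b : Fin k → ℤ), (∀ i, (q i).Prime) ∧ d = ∏ i, q i ∧
      (∀ i, IsCoprime (b i) (q i : ℤ)) ∧
      C = List.ofFn fun i => (∏ j ∈ Finset.Iio i, (q j : ℤ)) * b i := by
  constructor
  · intro h
    induction h with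
    | nil => exact ⟨0, Fin.elim0, Fin.elim0, fun i => i.elim0, by simp, fun i => i.elim0, by simp⟩
    | @cons q₀ d b₀ L hq hb h ih =>
      obtain ⟨k, q, b, h1, rfl, h2, rfl⟩ := ih
      refine ⟨k + 1, Fin.cons q₀ q, Fin.cons b₀ b, Fin.cases hq h1, ?_, Fin.cases hb h2, ?_⟩
      · simp [Fin.prod_univ_succ]
      · rw [ofFn_prod_Iio_succ]
        simp
  · rintro ⟨k, q, b, h1, rfl, h2, rfl⟩
    induction k with
    | zero => simpa using PrimeChain.nil
    | succ k ih =>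
      rw [ofFn_prod_Iio_succ, Fin.prod_univ_succ]
      exact PrimeChain.cons (h1 0) (h2 0) (ih _ _ (fun i => h1 i.succ) fun i => h2 i.succ)

theorem chainSeq_eq_map (n : ℕ) {k : ℕ} (q : Fin k → ℕ) (b : Fin k → ℤ) :
    chainSeq n q b = (List.ofFn fun i => (∏ j ∈ Finset.Iio i, (q j : ℤ)) * b i).map
      fun z : ℤ => (z : ZMod n) := by
  rw [chainSeq, List.map_ofFn]
  rfl

theorem isStarForm_iff {r p n : ℕ} (hn : n = 2 ^ r * p) (T : List (ZMod n)) :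
    IsStarForm n T ↔ ∃ L, IsStarList n p r L ∧ T = L.map fun z : ℤ => (z : ZMod n) := by
  constructor
  · rintro ⟨k, q, b, h1, h2, h3, rfl⟩
    refine ⟨_, ⟨_, primeChain_iff.2 ⟨k, q, b, h1, hn ▸ h2, h3, rfl⟩, rfl⟩, ?_⟩
    simp [chainSeq_eq_map]
  · rintro ⟨L, ⟨C, hC, rfl⟩, rfl⟩
    obtain ⟨k, q, b, h1, h2, h3, rfl⟩ := primeChain_iff.1 hC
    exact ⟨k, q, b, h1, hn ▸ h2, h3, by simp [chainSeq_eq_map]⟩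

theorem isAstForm_iff {s p n : ℕ} (hp : p.Prime) (hn : n = 2 ^ (s + 1) * p) (T : List (ZMod n)) :
    IsAstForm n T ↔ ∃ L, IsAstList n p (s + 1) L ∧ T = L.map fun z : ℤ => (z : ZMod n) := by
  have hn2 : n = 2 * (2 ^ s * p) := by rw [hn]; ring
  have hhalf : n / 2 = 2 ^ s * p := by omega
  constructor
  · rintro ⟨k, q, b, m, -, h1, h2, h3, h4, h5, rfl⟩
    refine ⟨_, ⟨s, _, m, rfl, primeChain_iff.2 ⟨k, q, b, h1, by omega, h3, rfl⟩, h4, h5, rfl⟩, ?_⟩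
    simp [chainSeq_eq_map, hhalf]
  · rintro ⟨L, ⟨s', C, m, hs, hC, h4, h5, rfl⟩, rfl⟩
    obtain rfl : s = s' := by omega
    obtain ⟨k, q, b, h1, h2, h3, rfl⟩ := primeChain_iff.1 hC
    refine ⟨k, q, b, m, Nat.pos_of_ne_zero ?_, h1, by omega, h3, h4, h5, ?_⟩
    · rintro rfl
      have : p ∣ 1 := ⟨2 ^ s, by rw [mul_comm, h2]; simp⟩
      exact hp.one_lt.ne' (Nat.dvd_one.1 this)
    · simp [chainSeq_eq_map, hhalf]

theorem two_pow_mul_prime_inj {s t p q : ℕ} (hp : p.Prime) (hp2 : p ≠ 2) (hq : q.Prime) (hq2 : q ≠ 2)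
    (h : 2 ^ s * p = 2 ^ t * q) : s = t ∧ p = q := by
  have key : ∀ {s t p q : ℕ}, p.Prime → q.Prime → p ≠ 2 → 2 ^ s * p = 2 ^ t * q → p = q := by
    intro s t p q hp hq hp2 h
    have h1 : p ∣ 2 ^ t * q := h ▸ Dvd.intro_left _ rfl
    rcases hp.dvd_mul.1 h1 with h1 | h1
    · exact (hp2 ((Nat.prime_dvd_prime_iff_eq hp Nat.prime_two).1 (hp.dvd_of_dvd_pow h1))).elim
    · exact (Nat.prime_dvd_prime_iff_eq hp hq).1 h1
  obtain rfl := key hp hq hp2 h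
  exact ⟨Nat.pow_right_injective le_rfl (Nat.eq_of_mul_eq_mul_right hp.pos h), rfl⟩

theorem isDoubleAstForm_iff {r p n : ℕ} (hp : p.Prime) (hp2 : p ≠ 2) (hn : n = 2 ^ r * p)
    (T : List (ZMod n)) :
    IsDoubleAstForm n T ↔ ∃ L, IsDoubleAstList n p r L ∧ T = L.map fun z : ℤ => (z : ZMod n) := by
  have hhalf : ∀ s, r = s + 1 → n / 2 = 2 ^ s * p := by
    rintro s rfl
    have : n = 2 * (2 ^ s * p) := by rw [hn]; ring
    omega
  constructor
  · rintro ⟨s, q, a, c, h1, h2, h3, h4, h5, rfl⟩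
    obtain ⟨rfl, rfl⟩ := two_pow_mul_prime_inj hp hp2 h1 h2 (hn.symm.trans h3)
    refine ⟨_, ⟨s, a, c, rfl, h4, h5, rfl⟩, ?_⟩
    simp [hhalf s rfl, Function.comp_def]
  · rintro ⟨L, ⟨s, a, c, rfl, h4, h5, rfl⟩, rfl⟩
    refine ⟨s, p, a, c, hp, hp2, hn, h4, h5, ?_⟩
    simp [hhalf s rfl, Function.comp_def]

theorem isExtremalTypes_seqTypes_iff {r p n : ℕ} (hr : 0 < r) (hp : p.Prime) (hp2 : p ≠ 2)
    (hn : n = 2 ^ r * p) (S : List (ZMod n)) :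
    IsExtremalTypes n p r (seqTypes p r S) ↔
      ∃ T : List (ZMod n), WeightEquivalent (unitWeights n) S T ∧
        (IsStarForm n T ∨ IsAstForm n T ∨ IsDoubleAstForm n T) := by
  obtain ⟨s, rfl⟩ : ∃ s, r = s + 1 := ⟨r - 1, by omega⟩
  simp only [isStarForm_iff hn, isAstForm_iff hp hn, isDoubleAstForm_iff hp hp2 hn,
    weightEquivalent_iff hr hp hp2 hn]
  constructor
  · rintro ⟨L, hL, h⟩
    refine ⟨_, h.trans (seqTypes_map_intCast hp hn L).symm, ?_⟩
    exact hL.imp (fun h => ⟨L, h, rfl⟩) (Or.imp (fun h => ⟨L, h, rfl⟩) fun h => ⟨L, h, rfl⟩)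
  · rintro ⟨T, h, ⟨L, hL, rfl⟩ | ⟨L, hL, rfl⟩ | ⟨L, hL, rfl⟩⟩ <;>
      rw [seqTypes_map_intCast hp hn] at h
    · exact ⟨L, Or.inl hL, h⟩
    · exact ⟨L, Or.inr (Or.inl hL), h⟩
    · exact ⟨L, Or.inr (Or.inr hL), h⟩

/-! ### The main theorem -/

/-- Let `n = 2 ^ r * p` with `p` an odd prime and `r ≥ 2`. A sequence in `ℤ/nℤ` with exactly one
odd term is `U(n)`-extremal for the Gao constant iff it is `U(n)`-equivalent to a sequence of
one of the forms `(⋆)`, `(∗)`, `(∗∗)`. Since `n` is even, `Odd` in the ring `ℤ/nℤ` is oddness of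
residues. -/
theorem mainTheorem6 (r p n : ℕ) (hr : 2 ≤ r) (hp : p.Prime) (hp2 : p ≠ 2)
    (hn : n = 2 ^ r * p) (S : List (ZMod n)) (hS : ∃! i : Fin S.length, Odd (S.get i)) :
    IsGaoExtremal (unitWeights n) S ↔
      ∃ T : List (ZMod n), WeightEquivalent (unitWeights n) S T ∧
        (IsStarForm n T ∨ IsAstForm n T ∨ IsDoubleAstForm n T) := by
  have h4 : 4 ≤ 2 ^ r := (Nat.pow_le_pow_right two_pos hr : 2 ^ 2 ≤ 2 ^ r)
  have hn4 : 4 ≤ n := by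
    rw [hn]
    exact h4.trans (Nat.le_mul_of_pos_right _ hp.pos)
  have hne : Even n := by
    rw [hn]
    exact (even_two.pow_of_ne_zero (by omega)).mul_right p
  have hr0 : 0 < r := by omega
  rw [← isExtremalTypes_seqTypes_iff hr0 hp hp2 hn, IsGaoExtremal,
    gaoConstant_unitWeights hr0 hp hp2 hn hne hn4, hasWeightedZeroSumSubseq_iff hr0 hp hp2 hn hne,
    Nat.add_right_cancel_iff, ← card_seqTypes p r S]
  exact ⟨fun h => isExtremalTypes_of_not_hasBalanced hne hn4 hp hp2 r _ fst_le_of_mem_seqTypes h.1 h.2,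
    fun h => not_hasBalanced_of_isExtremalTypes hne hn4 hp hp2 h⟩
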